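/- Let $k$ be a field and let $H$ be a finite-dimensional Hopf algebra over $k$, with comultiplication $\Delta(h)=h_1\otimes h_2$, counit $\varepsilon$ and antipode $S$ (which is then bijective). Let $\mathcal{LR}(H)$ be the category of Yetter–Drinfeld–Long bimodules: its objects are the $k$-vector spaces $M$ (of arbitrary dimension) with an $H$-bimodule structure $h\otimes m\mapsto h\cdot m$, $m\otimes h\mapsto m\cdot h$ and an $H$-bicomodule structure $m\mapsto m_{(-1)}\otimes m_{(0)}\in H\otimes M$, $m\mapsto m_{<0>}\otimes m_{<1>}\in M\otimes H$ such that, for all $h\in H$ and $m\in M$, $$(h_1\cdot m)_{(-1)}h_2\otimes(h_1\cdot m)_{(0)}=h_1m_{(-1)}\otimes h_2\cdot m_{(0)},\qquad (h\cdot m)_{<0>}\otimes(h\cdot m)_{<1>}=h\cdot m_{<0>}\otimes m_{<1>},$$ $$(m\cdot h_2)_{<0>}\otimes h_1(m\cdot h_2)_{<1>}=m_{<0>}\cdot h_1\otimes m_{<1>}h_2,\qquad (m\cdot h)_{(-1)}\otimes(m\cdot h)_{(0)}=m_{(-1)}\otimes m_{(0)}\cdot h,$$ and its morphisms are the $H$-bilinear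 and $H$-bicolinear maps. The tensor product of objects is the tensor product over $k$, with the diagonal actions and codiagonal coactions. The canonical braiding of $\mathcal{LR}(H)$ is $$c_{M,N}:M\otimes N\to N\otimes M,\qquad m\otimes n\mapsto m_{(-1)}\cdot n_{<0>}\otimes m_{(0)}\cdot n_{<1>},$$ with inverse $n\otimes m\mapsto m_{(0)}\cdot S^{-1}(n_{<1>})\otimes S^{-1}(m_{(-1)})\cdot n_{<0>}$. It is called pseudosymmetric if for all objects $X,Y,Z$ of $\mathcal{LR}(H)$ $$(c_{Y,Z}\otimes \mathrm{id}_X)(\mathrm{id}_Y\otimes c_{Z,X}^{-1})(c_{X,Y}\otimes \mathrm{id}_Z)=(\mathrm{id}_Z\otimes c_{X,Y})(c_{Z,X}^{-1}\otimes \mathrm{id}_Y)(\mathrm{id}_X\otimes c_{Y,Z})$$ as maps $X\otimes Y\otimes Z\to Z\otimes Y\otimes X$. **Proposition.** The canonical braiding of $\mathcal{LR}(H)$ is pseudosymmetric if and only if $H$ is commutative and cocommutative. -/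

import Mathlib

open TensorProduct

namespace HopfAlgebra
open Coalgebra

section
variable {k H : Type*} [Field k] [Ring H] [HopfAlgebra k H]

/-- `x ↦ ∑ f(x₁) x₂`. -/
noncomputable def coactDual (f : Module.Dual k H) : H →ₗ[k] H :=
  (TensorProduct.lid k H).toLinearMap ∘ₗ LinearMap.rTensor H f ∘ₗ comul

lemma coactDual_apply {ι : Type*} (f : Module.Dual k H) (x : H) (r : Repr k x ι) :
    coactDual f x = ∑ i ∈ r.index, f (r.left i) • r.right i := by
  simp [coactDual, ← r.eq, map_sum]

lemma sum_antipode_antipode_mul (a : H) {ι : Type*} (r : Repr k a ι) :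
    ∑ i ∈ r.index, antipode k (r.right i) * antipode k (antipode k (r.left i)) =
      algebraMap k H (counit a) := by
  have := congrArg (antipode k) (sum_antipode_mul_eq_smul r)
  simpa [antipode_mul_antidistrib, Algebra.algebraMap_eq_smul_one] using this

lemma sum_antipode_antipode_mul' (a : H) {ι : Type*} (r : Repr k a ι) :
    ∑ i ∈ r.index, antipode k (antipode k (r.right i)) * antipode k (r.left i) =
      algebraMap k H (counit a) := by
  have := congrArg (antipode k) (sum_mul_antipode_eq_smul r)
  simpa [antipode_mul_antidistrib, Algebra.algebraMap_eq_smul_one] using this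

lemma coactDual_mulLeft (f : Module.Dual k H) (a y : H) {ι : Type*} (r : Repr k a ι) :
    antipode k (antipode k (coactDual (f ∘ₗ LinearMap.mulLeft k a) y)) =
      ∑ i ∈ r.index, antipode k (r.right i) *
        antipode k (antipode k (coactDual f (r.left i * y))) := by
  have key : ∀ p q : H, ∑ i ∈ r.index, ∑ j ∈ (ℛ k (r.left i)).index,
      f ((ℛ k (r.left i)).left j * p) • (antipode k (r.right i) *
        (antipode k (antipode k ((ℛ k (r.left i)).right j)) * q)) = f (a * p) • q := by
    intro p q
    have h := sum_tmul_tmul_eq r (fun i => ℛ k (r.left i)) (fun i => ℛ k (r.right i))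
    let T : H ⊗[k] (H ⊗[k] H) →ₗ[k] H :=
      TensorProduct.lift ((LinearMap.lsmul k H).compl₁₂ (f ∘ₗ LinearMap.mulRight k p)
        (LinearMap.mulRight k q ∘ₗ LinearMap.mul' k H ∘ₗ
          TensorProduct.map (antipode k) (antipode k ∘ₗ antipode k) ∘ₗ
          (TensorProduct.comm k H H).toLinearMap))
    have h2 := congrArg T h
    simp only [map_sum] at h2
    have e : ∀ x y z : H, T (x ⊗ₜ (y ⊗ₜ z)) = f (x * p) • (antipode k z *
        (antipode k (antipode k y) * q)) := by
      intro x y z; simp [T, mul_assoc]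
    simp only [e] at h2
    rw [h2]
    have h3 : ∀ i, ∑ j ∈ (ℛ k (r.right i)).index, f (r.left i * p) •
        (antipode k ((ℛ k (r.right i)).right j) *
        (antipode k (antipode k ((ℛ k (r.right i)).left j)) * q)) =
        f ((counit (R := k) (r.right i) • r.left i) * p) • q := by
      intro i
      simp only [← mul_assoc]
      rw [← Finset.smul_sum, ← Finset.sum_mul, sum_antipode_antipode_mul]
      simp [Algebra.algebraMap_eq_smul_one, smul_smul, mul_comm]
    simp only [h3, ← Finset.sum_smul, ← map_sum, ← Finset.sum_mul]
    congr 3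
    have := congrArg (TensorProduct.rid k H) (sum_tmul_counit_eq r)
    simpa only [map_sum, TensorProduct.rid_tmul, one_smul] using this
  have hy := coactDual_apply (f ∘ₗ LinearMap.mulLeft k a) y (ℛ k y)
  rw [hy]
  have hl : ∀ i, coactDual f (r.left i * y) = ∑ j ∈ (ℛ k (r.left i)).index,
      ∑ l ∈ (ℛ k y).index, f ((ℛ k (r.left i)).left j * (ℛ k y).left l) •
        ((ℛ k (r.left i)).right j * (ℛ k y).right l) := by
    intro i
    rw [coactDual, LinearMap.comp_apply, LinearMap.comp_apply, Bialgebra.comul_mul,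
      ← (ℛ k y).eq, ← (ℛ k (r.left i)).eq]
    simp [Finset.sum_mul, Finset.mul_sum]
    try rw [Finset.sum_comm]
  simp only [hl, map_sum, map_smul, antipode_mul_antidistrib, Finset.mul_sum]
  simp only [LinearMap.comp_apply, LinearMap.mulLeft_apply, ← key]
  rw [Finset.sum_comm]
  refine Finset.sum_congr rfl fun i _ => ?_
  rw [Finset.sum_comm]
  refine Finset.sum_congr rfl fun j _ => ?_
  refine Finset.sum_congr rfl fun l _ => ?_
  rw [mul_smul_comm]

lemma sum_antipode_antipode_mul_convolution (T : H →ₗ[k] H) (x : H) {ι : Type*}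
    (r : Repr k x ι) :
    ∑ i ∈ r.index, antipode k (antipode k (r.right i)) *
      (∑ j ∈ (ℛ k (r.left i)).index, antipode k ((ℛ k (r.left i)).right j) *
        T ((ℛ k (r.left i)).left j)) = T x := by
  have h := sum_tmul_tmul_eq r (fun i => ℛ k (r.left i)) (fun i => ℛ k (r.right i))
  let F : H ⊗[k] (H ⊗[k] H) →ₗ[k] H :=
    LinearMap.mul' k H ∘ₗ (TensorProduct.comm k H H).toLinearMap ∘ₗ
      TensorProduct.map T (LinearMap.mul' k H ∘ₗ
          TensorProduct.map (antipode k ∘ₗ antipode k) (antipode k) ∘ₗ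
          (TensorProduct.comm k H H).toLinearMap)
  have e : ∀ x y z : H, F (x ⊗ₜ (y ⊗ₜ z)) =
      antipode k (antipode k z) * antipode k y * T x := by
    intro x y z; simp [F]
  have h2 := congrArg F h
  simp only [map_sum, e] at h2
  simp only [Finset.mul_sum, ← mul_assoc]
  rw [h2]
  simp only [← Finset.sum_mul, sum_antipode_antipode_mul', Algebra.algebraMap_eq_smul_one,
    smul_mul_assoc, one_mul, ← map_smul]
  rw [← map_sum]
  congr 1
  have := congrArg (TensorProduct.rid k H) (sum_tmul_counit_eq r)
  simpa only [map_sum, TensorProduct.rid_tmul, one_smul] using this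

variable [FiniteDimensional k H]

/-- The operator `x ↦ ∑ f(x₁) S²(x₂) h`. -/
noncomputable def integralOp (h : H) (f : Module.Dual k H) : H →ₗ[k] H :=
  LinearMap.mulRight k h ∘ₗ antipode k ∘ₗ antipode k ∘ₗ coactDual f

lemma trace_integralOp_mulLeft (h : H) (f : Module.Dual k H) (a : H) :
    LinearMap.trace k H (integralOp h (f ∘ₗ LinearMap.mulLeft k a)) =
      counit (R := k) a * LinearMap.trace k H (integralOp h f) := by
  have h1 : integralOp h (f ∘ₗ LinearMap.mulLeft k a) =
      ∑ i ∈ (ℛ k a).index, (LinearMap.mulLeft k (antipode k ((ℛ k a).right i)) ∘ₗ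
        integralOp h f) ∘ₗ LinearMap.mulLeft k ((ℛ k a).left i) := by
    ext y
    simp [integralOp, coactDual_mulLeft f a y (ℛ k a), Finset.sum_mul, mul_assoc]
  have h2 : ∀ i, LinearMap.trace k H
      ((LinearMap.mulLeft k (antipode k ((ℛ k a).right i)) ∘ₗ
        integralOp h f) ∘ₗ LinearMap.mulLeft k ((ℛ k a).left i)) =
      LinearMap.trace k H
        (LinearMap.mulLeft k ((ℛ k a).left i * antipode k ((ℛ k a).right i)) ∘ₗ
          integralOp h f) := by
    intro i
    rw [LinearMap.trace_comp_comm', ← LinearMap.comp_assoc, LinearMap.mulLeft_mul]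
  rw [h1, map_sum]
  simp only [h2]
  rw [← map_sum, ← smul_eq_mul, ← map_smul]
  congr 1
  ext y
  have := sum_mul_antipode_eq_smul (ℛ k a)
  simp only [LinearMap.sum_apply, LinearMap.comp_apply, LinearMap.mulLeft_apply,
    ← Finset.sum_mul, this]
  simp

variable (k H) in
/-- A finite-dimensional Hopf algebra has a nonzero left integral. -/
lemma exists_left_integral : ∃ Λ : H, Λ ≠ 0 ∧ ∀ a : H, a * Λ = counit (R := k) a • Λ := by
  by_contra! hcon
  let b := Module.finBasis k H
  have hadd : ∀ h, IsLinearMap k fun f : Module.Dual k H =>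
      LinearMap.trace k H (integralOp h f) := by
    intro h
    constructor
    · intro f g
      rw [← map_add]; congr 1; ext y
      simp [integralOp, coactDual, LinearMap.rTensor_add, add_mul]
    · intro c f
      rw [← map_smul]; congr 1; ext y
      simp [integralOp, coactDual, LinearMap.rTensor_smul]
  have hzero : ∀ h f, LinearMap.trace k H (integralOp (k := k) (H := H) h f) = 0 := by
    intro h f
    let φ : Module.Dual k (Module.Dual k H) := (hadd h).mk'
    obtain ⟨Λ, hΛ⟩ := (Module.evalEquiv k H).surjective φ
    have hf : ∀ f : Module.Dual k H, f Λ = LinearMap.trace k H (integralOp h f) := by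
      intro f
      have := congrArg (fun ψ => ψ f) hΛ
      simpa [φ] using this
    have hint : ∀ a : H, a * Λ = counit (R := k) a • Λ := by
      intro a
      refine (Module.forall_dual_apply_eq_zero_iff k _).1 ?_ |> sub_eq_zero.1
      intro g
      have := trace_integralOp_mulLeft h g a
      rw [← hf, ← hf] at this
      simp at this
      simp [this]
    have h0 : Λ = 0 := by
      by_contra hne
      obtain ⟨a, ha⟩ := hcon Λ hne
      exact ha (hint a)
    rw [← hf, h0, map_zero]
  have hne : Nontrivial H := by
    refine ⟨0, 1, fun h => ?_⟩
    have := congrArg (counit (R := k)) h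
    simp at this
  obtain ⟨i⟩ := b.index_nonempty
  let T : H →ₗ[k] H := (b.coord i).smulRight (b i)
  let G : H →ₗ[k] H := LinearMap.mul' k H ∘ₗ TensorProduct.map (antipode k) T ∘ₗ
    (TensorProduct.comm k H H).toLinearMap ∘ₗ comul
  have hG : ∀ x, G x = ∑ j ∈ (ℛ k x).index, antipode k ((ℛ k x).right j) *
      T ((ℛ k x).left j) := by
    intro x
    simp only [G, LinearMap.comp_apply]
    rw [← (ℛ k x).eq]
    simp
  have hT : ∑ j, integralOp (G (b j)) (b.coord j) = T := by
    ext x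
    have h1 : ∀ j, integralOp (G (b j)) (b.coord j) x = ∑ l ∈ (ℛ k x).index,
        antipode k (antipode k ((ℛ k x).right l)) *
          (b.coord j ((ℛ k x).left l) • G (b j)) := by
      intro j
      simp [integralOp, coactDual_apply _ _ (ℛ k x), Finset.sum_mul]
    rw [LinearMap.sum_apply]
    simp only [h1]
    rw [Finset.sum_comm, ← sum_antipode_antipode_mul_convolution T x (ℛ k x)]
    refine Finset.sum_congr rfl fun l _ => ?_
    rw [← Finset.mul_sum, ← hG]
    congr 1
    simp only [← map_smul, ← map_sum]
    congr 1
    exact b.sum_repr _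
  have h1 : LinearMap.trace k H T = 1 := by
    simp [T, LinearMap.trace_smulRight]
  rw [← hT, map_sum] at h1
  simp [hzero] at h1

variable (k H) in
lemma antipode_injective : Function.Injective (antipode k : H →ₗ[k] H) := by
  rw [← LinearMap.ker_eq_bot, LinearMap.ker_eq_bot']
  intro a ha
  obtain ⟨Λ, hΛ, hint⟩ := exists_left_integral k H
  let r := ℛ k Λ
  -- `S(a) Λ₁ ⊗ Λ₂ = Λ₁ ⊗ a Λ₂`
  have key : ∀ a : H, ∑ i ∈ r.index, (antipode k a * r.left i) ⊗ₜ[k] r.right i =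
      ∑ i ∈ r.index, r.left i ⊗ₜ[k] (a * r.right i) := by
    intro a
    let A := ℛ k a
    have h := sum_tmul_tmul_eq A (fun i => ℛ k (A.left i)) (fun i => ℛ k (A.right i))
    let F : H ⊗[k] (H ⊗[k] H) →ₗ[k] H ⊗[k] H :=
      LinearMap.mulRight k (comul Λ) ∘ₗ LinearMap.rTensor H (LinearMap.mul' k H) ∘ₗ
      (TensorProduct.assoc k H H H).symm.toLinearMap ∘ₗ LinearMap.rTensor (H ⊗[k] H) (antipode k)
    have e : ∀ x y z : H, F (x ⊗ₜ (y ⊗ₜ z)) = ((antipode k x * y) ⊗ₜ z) * comul Λ := by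
      intro x y z; simp [F]
    have h2 := congrArg F h
    simp only [map_sum, e] at h2
    have hL : ∑ i ∈ A.index, ∑ j ∈ (ℛ k (A.left i)).index,
        ((antipode k ((ℛ k (A.left i)).left j) * (ℛ k (A.left i)).right j) ⊗ₜ[k] A.right i) *
          comul Λ = ∑ i ∈ r.index, r.left i ⊗ₜ[k] (a * r.right i) := by
      simp only [← Finset.sum_mul, ← TensorProduct.sum_tmul, sum_antipode_mul_eq_smul]
      simp only [TensorProduct.smul_tmul, ← TensorProduct.tmul_sum, sum_counit_smul]
      rw [← r.eq]
      simp [Finset.mul_sum]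
    have hR : ∑ i ∈ A.index, ∑ j ∈ (ℛ k (A.right i)).index,
        ((antipode k (A.left i) * (ℛ k (A.right i)).left j) ⊗ₜ[k] (ℛ k (A.right i)).right j) *
          comul Λ = ∑ i ∈ r.index, (antipode k a * r.left i) ⊗ₜ[k] r.right i := by
      have h3 : ∀ i, ∑ j ∈ (ℛ k (A.right i)).index,
        ((antipode k (A.left i) * (ℛ k (A.right i)).left j) ⊗ₜ[k] (ℛ k (A.right i)).right j) *
          comul Λ = ((antipode k (counit (R := k) (A.right i) • A.left i)) ⊗ₜ[k] 1) * comul Λ := by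
        intro i
        have : ∀ x y z : H, (x * y) ⊗ₜ[k] z = (x ⊗ₜ[k] 1) * (y ⊗ₜ[k] z) := by
          intro x y z; simp
        simp only [this, ← Finset.sum_mul, ← Finset.mul_sum]
        rw [(ℛ k (A.right i)).eq, mul_assoc, ← Bialgebra.comul_mul, hint]
        simp [← TensorProduct.smul_tmul']
      simp only [h3, ← Finset.sum_mul, ← TensorProduct.sum_tmul, ← map_sum]
      have := congrArg (TensorProduct.rid k H) (sum_tmul_counit_eq A)
      simp only [map_sum, TensorProduct.rid_tmul, one_smul] at this
      rw [this, ← r.eq]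
      simp [Finset.mul_sum]
    rw [← hR, ← hL, h2]
  have hz : ∀ c : H, ∑ i ∈ r.index, r.left i ⊗ₜ[k] (a * c * r.right i) = 0 := by
    intro c
    rw [← key]
    simp [antipode_mul_antidistrib, ha]
  let b := Module.finBasis k H
  -- `Λ ⊗ a = Λ₁ ⊗ a S(Λ₂) Λ₃ = 0`
  have h := sum_tmul_tmul_eq r (fun i => ℛ k (r.left i)) (fun i => ℛ k (r.right i))
  let F : H ⊗[k] (H ⊗[k] H) →ₗ[k] H ⊗[k] H := LinearMap.lTensor H
    (LinearMap.mulLeft k a ∘ₗ LinearMap.mul' k H ∘ₗ LinearMap.rTensor H (antipode k))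
  have e : ∀ x y z : H, F (x ⊗ₜ (y ⊗ₜ z)) = x ⊗ₜ (a * (antipode k y * z)) := by
    intro x y z; simp [F]
  have h2 := congrArg F h
  simp only [map_sum, e] at h2
  simp only [← TensorProduct.tmul_sum, ← Finset.mul_sum, sum_antipode_mul_eq_smul] at h2
  have hR : ∑ i ∈ r.index, r.left i ⊗ₜ[k] (a * counit (R := k) (r.right i) • 1) = Λ ⊗ₜ[k] a := by
    have := congrArg (TensorProduct.rid k H) (sum_tmul_counit_eq r)
    simp only [map_sum, TensorProduct.rid_tmul, one_smul] at this
    simp only [mul_smul_comm, mul_one, ← TensorProduct.smul_tmul, ← TensorProduct.sum_tmul, this]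
  have hL : ∑ i ∈ r.index, ∑ j ∈ (ℛ k (r.left i)).index, (ℛ k (r.left i)).left j ⊗ₜ[k]
      (a * (antipode k ((ℛ k (r.left i)).right j) * r.right i)) = 0 := by
    have h4 : ∀ x y z : H, x ⊗ₜ[k] (a * (antipode k y * z)) =
        ∑ l, (b.coord l y • x) ⊗ₜ[k] (a * antipode k (b l) * z) := by
      intro x y z
      simp only [TensorProduct.smul_tmul, ← TensorProduct.tmul_sum]
      congr 1
      have hy : ∑ l, b.coord l y • b l = y := b.sum_repr y
      conv_lhs => rw [← hy, map_sum, Finset.sum_mul, Finset.mul_sum]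
      refine Finset.sum_congr rfl fun l _ => ?_
      rw [map_smul, smul_mul_assoc, mul_smul_comm, mul_assoc]
    have h5 : ∀ l i, ∑ j ∈ (ℛ k (r.left i)).index,
        (b.coord l ((ℛ k (r.left i)).right j) • (ℛ k (r.left i)).left j) ⊗ₜ[k]
          (a * antipode k (b l) * r.right i) =
        (LinearMap.rTensor H ((TensorProduct.rid k H).toLinearMap ∘ₗ
          LinearMap.lTensor H (b.coord l) ∘ₗ comul))
          (r.left i ⊗ₜ[k] (a * antipode k (b l) * r.right i)) := by
      intro l i
      rw [LinearMap.rTensor_tmul, LinearMap.comp_apply, LinearMap.comp_apply,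
        ← (ℛ k (r.left i)).eq]
      simp [TensorProduct.sum_tmul]
    simp only [h4]
    have : ∀ i, ∑ j ∈ (ℛ k (r.left i)).index, ∑ l,
        (b.coord l ((ℛ k (r.left i)).right j) • (ℛ k (r.left i)).left j) ⊗ₜ[k]
          (a * antipode k (b l) * r.right i) = ∑ l, ∑ j ∈ (ℛ k (r.left i)).index,
        (b.coord l ((ℛ k (r.left i)).right j) • (ℛ k (r.left i)).left j) ⊗ₜ[k]
          (a * antipode k (b l) * r.right i) := fun i => Finset.sum_comm
    simp only [this, h5]
    rw [Finset.sum_comm]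
    simp only [← map_sum, hz, map_zero, Finset.sum_const_zero]
  rw [hL] at h2
  erw [hR] at h2
  obtain ⟨f, hf⟩ : ∃ f : Module.Dual k H, f Λ ≠ 0 := by
    by_contra! hall
    exact hΛ ((Module.forall_dual_apply_eq_zero_iff k Λ).1 hall)
  have h6 := congrArg (TensorProduct.lid k H ∘ LinearMap.rTensor H f) h2
  simp only [Function.comp_apply, map_zero, LinearMap.rTensor_tmul, TensorProduct.lid_tmul] at h6
  exact (smul_eq_zero.1 h6.symm).resolve_left hf

variable (k H) in
/-- The antipode of a finite-dimensional Hopf algebra over a field is bijective. -/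
lemma antipode_bijective : Function.Bijective (antipode k : H →ₗ[k] H) :=
  ⟨antipode_injective k H, LinearMap.injective_iff_surjective.1 (antipode_injective k H)⟩

variable (k H) in
/-- The inverse `S⁻¹` of the antipode of a finite-dimensional Hopf algebra over a field. -/
noncomputable def antipodeInv : H →ₗ[k] H :=
  (LinearEquiv.ofBijective (antipode k : H →ₗ[k] H) (antipode_bijective k H)).symm.toLinearMap

@[simp] lemma antipode_antipodeInv (x : H) : antipode k (antipodeInv k H x) = x :=
  (LinearEquiv.ofBijective (antipode k : H →ₗ[k] H) (antipode_bijective k H)).apply_symm_apply x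

lemma mul_antipodeInv_comul (x : H) :
    (LinearMap.mul' k H ∘ₗ LinearMap.rTensor H (antipodeInv k H))
      (TensorProduct.comm k H H (comul x)) = counit (R := k) x • 1 := by
  apply antipode_injective k H
  rw [← (ℛ k x).eq]
  simp [antipode_mul_antidistrib, sum_antipode_mul_eq_smul]

lemma mul_antipodeInv_comul' (x : H) :
    (LinearMap.mul' k H ∘ₗ LinearMap.lTensor H (antipodeInv k H))
      (TensorProduct.comm k H H (comul x)) = counit (R := k) x • 1 := by
  apply antipode_injective k H
  rw [← (ℛ k x).eq]
  simp [antipode_mul_antidistrib, sum_mul_antipode_eq_smul]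

end
end HopfAlgebra

open Coalgebra HopfAlgebra MulOpposite

universe u v w

/-- A Yetter-Drinfeld-Long bimodule over a bialgebra `H`, i.e. an object of the category `LR(H)`:
a `k`-vector space with an `H`-bimodule structure and an `H`-bicomodule structure that make it a
left-left Yetter-Drinfeld module (`yd_left`), a left-right Long module (`long_left`), a right-right
Yetter-Drinfeld module (`yd_right`) and a right-left Long module (`long_right`).
A left (right) `H`-module structure is given as an algebra map from `H` (from `Hᵐᵒᵖ`) to the
endomorphisms. Sums over `r : Repr k h _` are sums `∑ h₁ ⊗ h₂` representing `Δ(h)`. -/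
structure LRBimodule (k : Type u) (H : Type v) [Field k] [Ring H] [Bialgebra k H] where
  carrier : Type w
  [addCommGroup : AddCommGroup carrier]
  [module : Module k carrier]
  /-- The left action, `lact h m = h · m`. -/
  lact : H →ₐ[k] Module.End k carrier
  /-- The right action, `ract (op h) m = m · h`. -/
  ract : Hᵐᵒᵖ →ₐ[k] Module.End k carrier
  lact_ract : ∀ (h h' : H) (m : carrier), lact h (ract (op h') m) = ract (op h') (lact h m)
  /-- The left coaction, `lcoact m = m₍₋₁₎ ⊗ m₍₀₎`. -/
  lcoact : carrier →ₗ[k] H ⊗[k] carrier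
  lcoact_coassoc : (TensorProduct.assoc k H H carrier).toLinearMap ∘ₗ
      LinearMap.rTensor carrier comul ∘ₗ lcoact = LinearMap.lTensor H lcoact ∘ₗ lcoact
  lcoact_counit : LinearMap.rTensor carrier counit ∘ₗ lcoact = TensorProduct.mk k k carrier 1
  /-- The right coaction, `rcoact m = m_{<0>} ⊗ m_{<1>}`. -/
  rcoact : carrier →ₗ[k] carrier ⊗[k] H
  rcoact_coassoc : (TensorProduct.assoc k carrier H H).toLinearMap ∘ₗ
      LinearMap.rTensor H rcoact ∘ₗ rcoact = LinearMap.lTensor carrier comul ∘ₗ rcoact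
  rcoact_counit :
    LinearMap.lTensor carrier counit ∘ₗ rcoact = (TensorProduct.mk k carrier k).flip 1
  lcoact_rcoact : (TensorProduct.assoc k H carrier H).toLinearMap ∘ₗ
      LinearMap.rTensor H lcoact ∘ₗ rcoact = LinearMap.lTensor H rcoact ∘ₗ lcoact
  /-- `(h₁ · m)₍₋₁₎ h₂ ⊗ (h₁ · m)₍₀₎ = h₁ m₍₋₁₎ ⊗ h₂ · m₍₀₎`. -/
  yd_left : ∀ (h : H) (m : carrier) (r : Repr k h (H × H)),
    ∑ i ∈ r.index, LinearMap.rTensor carrier (LinearMap.mulRight k (r.right i))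
        (lcoact (lact (r.left i) m)) =
      ∑ i ∈ r.index, TensorProduct.map (LinearMap.mulLeft k (r.left i)) (lact (r.right i))
        (lcoact m)
  /-- `(h · m)_{<0>} ⊗ (h · m)_{<1>} = h · m_{<0>} ⊗ m_{<1>}`. -/
  long_left : ∀ (h : H) (m : carrier), rcoact (lact h m) = LinearMap.rTensor H (lact h) (rcoact m)
  /-- `(m · h₂)_{<0>} ⊗ h₁ (m · h₂)_{<1>} = m_{<0>} · h₁ ⊗ m_{<1>} h₂`. -/
  yd_right : ∀ (h : H) (m : carrier) (r : Repr k h (H × H)),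
    ∑ i ∈ r.index, LinearMap.lTensor carrier (LinearMap.mulLeft k (r.left i))
        (rcoact (ract (op (r.right i)) m)) =
      ∑ i ∈ r.index, TensorProduct.map (ract (op (r.left i))) (LinearMap.mulRight k (r.right i))
        (rcoact m)
  /-- `(m · h)₍₋₁₎ ⊗ (m · h)₍₀₎ = m₍₋₁₎ ⊗ m₍₀₎ · h`. -/
  long_right : ∀ (h : H) (m : carrier),
    lcoact (ract (op h) m) = LinearMap.lTensor H (ract (op h)) (lcoact m)

namespace LRBimodule

section Bialgebra
variable {k : Type u} {H : Type v} [Field k] [Ring H] [Bialgebra k H]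

instance : CoeSort (LRBimodule.{u, v, w} k H) (Type w) := ⟨carrier⟩

instance (M : LRBimodule.{u, v, w} k H) : AddCommGroup M := M.addCommGroup

instance (M : LRBimodule.{u, v, w} k H) : Module k M := M.module

/-- The left action as a linear map `h ⊗ m ↦ h · m`. -/
noncomputable def lactMap (M : LRBimodule.{u, v, w} k H) : H ⊗[k] M →ₗ[k] M :=
  TensorProduct.lift M.lact.toLinearMap

/-- The right action as a linear map `m ⊗ h ↦ m · h`. -/
noncomputable def ractMap (M : LRBimodule.{u, v, w} k H) : M ⊗[k] H →ₗ[k] M :=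
  TensorProduct.lift (M.ract.toLinearMap ∘ₗ (opLinearEquiv k).toLinearMap).flip

@[simp] lemma lactMap_tmul (M : LRBimodule.{u, v, w} k H) (h : H) (m : M) :
    M.lactMap (h ⊗ₜ m) = M.lact h m := rfl

@[simp] lemma ractMap_tmul (M : LRBimodule.{u, v, w} k H) (h : H) (m : M) :
    M.ractMap (m ⊗ₜ h) = M.ract (op h) m := rfl

/-- The map `(h ⊗ m) ⊗ (n ⊗ h') ↦ h · n ⊗ m · h'`. -/
noncomputable def crossAct (M N : LRBimodule.{u, v, w} k H) :
    (H ⊗[k] M) ⊗[k] (N ⊗[k] H) →ₗ[k] N ⊗[k] M :=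
  TensorProduct.map N.lactMap M.ractMap ∘ₗ
    (TensorProduct.tensorTensorTensorComm k H M N H).toLinearMap

@[simp] lemma crossAct_tmul (M N : LRBimodule.{u, v, w} k H) (h h' : H) (m : M) (n : N) :
    crossAct M N ((h ⊗ₜ m) ⊗ₜ (n ⊗ₜ h')) = N.lact h n ⊗ₜ M.ract (op h') m := rfl

/-- The map `m ⊗ n ↦ m₍₋₁₎ · n_{<0>} ⊗ m₍₀₎ · n_{<1>}`. -/
noncomputable def braidingHom (M N : LRBimodule.{u, v, w} k H) : M ⊗[k] N →ₗ[k] N ⊗[k] M :=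
  crossAct M N ∘ₗ TensorProduct.map M.lcoact N.rcoact

lemma braidingHom_tmul (M N : LRBimodule.{u, v, w} k H) (m : M) (n : N) :
    braidingHom M N (m ⊗ₜ n) = crossAct M N (M.lcoact m ⊗ₜ N.rcoact n) := rfl

/-- Pseudosymmetry of a braiding `c` of `LR(H)`: for all objects `X`, `Y`, `Z`, both sides being
maps `X ⊗ Y ⊗ Z → Z ⊗ Y ⊗ X`,
`(c_{Y,Z} ⊗ X) (Y ⊗ c_{Z,X}⁻¹) (c_{X,Y} ⊗ Z) = (Z ⊗ c_{X,Y}) (c_{Z,X}⁻¹ ⊗ Y) (X ⊗ c_{Y,Z})`.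
Morphisms of `LR(H)` are particular linear maps, the tensor product of objects is the tensor
product of vector spaces, and the associators are those of vector spaces, so that this is an
equality of linear maps. -/
def IsPseudosymmetric (c : ∀ M N : LRBimodule.{u, v, w} k H, M ⊗[k] N ≃ₗ[k] N ⊗[k] M) : Prop :=
  ∀ X Y Z : LRBimodule.{u, v, w} k H,
    LinearMap.rTensor X (c Y Z).toLinearMap ∘ₗ
        (TensorProduct.assoc k Y Z X).symm.toLinearMap ∘ₗ
        LinearMap.lTensor Y (c Z X).symm.toLinearMap ∘ₗ
        (TensorProduct.assoc k Y X Z).toLinearMap ∘ₗ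
        LinearMap.rTensor Z (c X Y).toLinearMap =
      (TensorProduct.assoc k Z Y X).symm.toLinearMap ∘ₗ
        LinearMap.lTensor Z (c X Y).toLinearMap ∘ₗ
        (TensorProduct.assoc k Z X Y).toLinearMap ∘ₗ
        LinearMap.rTensor Y (c Z X).symm.toLinearMap ∘ₗ
        (TensorProduct.assoc k X Z Y).symm.toLinearMap ∘ₗ
        LinearMap.lTensor X (c Y Z).toLinearMap ∘ₗ
        (TensorProduct.assoc k X Y Z).toLinearMap

end Bialgebra

section Hopf
variable {k : Type u} {H : Type v} [Field k] [Ring H] [HopfAlgebra k H] [FiniteDimensional k H]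

/-- The map `n ⊗ m ↦ m₍₀₎ · S⁻¹(n_{<1>}) ⊗ S⁻¹(m₍₋₁₎) · n_{<0>}`. -/
noncomputable def braidingInv (M N : LRBimodule.{u, v, w} k H) : N ⊗[k] M →ₗ[k] M ⊗[k] N :=
  (TensorProduct.comm k N M).toLinearMap ∘ₗ crossAct M N ∘ₗ
    TensorProduct.map (LinearMap.rTensor M (antipodeInv k H) ∘ₗ M.lcoact)
      (LinearMap.lTensor N (antipodeInv k H) ∘ₗ N.rcoact) ∘ₗ
    (TensorProduct.comm k N M).toLinearMap

lemma braidingInv_tmul (M N : LRBimodule.{u, v, w} k H) (m : M) (n : N) :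
    braidingInv M N (n ⊗ₜ m) = TensorProduct.comm k N M (crossAct M N
      (LinearMap.rTensor M (antipodeInv k H) (M.lcoact m) ⊗ₜ
        LinearMap.lTensor N (antipodeInv k H) (N.rcoact n))) := rfl

/-- `h ⊗ h' ⊗ m ↦ g(h' ⊗ h) ⊗ m`. -/
noncomputable def lcancelMap (M : LRBimodule.{u, v, w} k H) (g : H ⊗[k] H →ₗ[k] H) :
    H ⊗[k] (H ⊗[k] M) →ₗ[k] H ⊗[k] M :=
  LinearMap.rTensor M (g ∘ₗ (TensorProduct.comm k H H).toLinearMap) ∘ₗ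
    (TensorProduct.assoc k H H M).symm.toLinearMap

/-- `m ⊗ h ⊗ h' ↦ m ⊗ g(h' ⊗ h)`. -/
noncomputable def rcancelMap (M : LRBimodule.{u, v, w} k H) (g : H ⊗[k] H →ₗ[k] H) :
    (M ⊗[k] H) ⊗[k] H →ₗ[k] M ⊗[k] H :=
  LinearMap.lTensor M (g ∘ₗ (TensorProduct.comm k H H).toLinearMap) ∘ₗ
    (TensorProduct.assoc k M H H).toLinearMap

lemma lcancelMap_tmul (M : LRBimodule.{u, v, w} k H) (g : H ⊗[k] H →ₗ[k] H) (a b : H) (m : M) :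
    M.lcancelMap g (a ⊗ₜ (b ⊗ₜ m)) = g (b ⊗ₜ a) ⊗ₜ m := rfl

lemma rcancelMap_tmul (M : LRBimodule.{u, v, w} k H) (g : H ⊗[k] H →ₗ[k] H) (a b : H) (m : M) :
    M.rcancelMap g ((m ⊗ₜ a) ⊗ₜ b) = m ⊗ₜ g (b ⊗ₜ a) := rfl

/-- Given a linear map `g`, `h ⊗ h' ⊗ m ↦ g(h' ⊗ h) ⊗ m` sends `m₍₋₁₎ ⊗ m₍₀₎₍₋₁₎ ⊗ m₍₀₎₍₀₎` to `1 ⊗ m`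
provided that `g(h₂ ⊗ h₁) = ε(h)`. -/
lemma lcoact_cancel (M : LRBimodule.{u, v, w} k H) (g : H ⊗[k] H →ₗ[k] H)
    (hg : ∀ x : H, g (TensorProduct.comm k H H (comul x)) = counit (R := k) x • 1) (m : M) :
    M.lcancelMap g (LinearMap.lTensor H M.lcoact (M.lcoact m)) = 1 ⊗ₜ m := by
  have h1 := LinearMap.congr_fun M.lcoact_coassoc m
  have h2 := LinearMap.congr_fun M.lcoact_counit m
  simp only [LinearMap.comp_apply, LinearEquiv.coe_coe] at h1 h2
  rw [lcancelMap, LinearMap.comp_apply, LinearEquiv.coe_coe, ← h1, LinearEquiv.symm_apply_apply, ← LinearMap.comp_apply, ← LinearMap.rTensor_comp]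
  have h3 : (g ∘ₗ (TensorProduct.comm k H H).toLinearMap) ∘ₗ comul =
      (LinearMap.toSpanSingleton k H 1) ∘ₗ counit := by
    ext x; simp [hg]
  rw [h3, LinearMap.rTensor_comp, LinearMap.comp_apply, h2]
  simp

lemma rcoact_cancel (M : LRBimodule.{u, v, w} k H) (g : H ⊗[k] H →ₗ[k] H)
    (hg : ∀ x : H, g (TensorProduct.comm k H H (comul x)) = counit (R := k) x • 1) (m : M) :
    M.rcancelMap g (LinearMap.rTensor H M.rcoact (M.rcoact m)) = m ⊗ₜ 1 := by
  have h1 := LinearMap.congr_fun M.rcoact_coassoc m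
  have h2 := LinearMap.congr_fun M.rcoact_counit m
  simp only [LinearMap.comp_apply, LinearEquiv.coe_coe] at h1 h2
  rw [rcancelMap, LinearMap.comp_apply, LinearEquiv.coe_coe, h1, ← LinearMap.comp_apply, ← LinearMap.lTensor_comp]
  have h3 : (g ∘ₗ (TensorProduct.comm k H H).toLinearMap) ∘ₗ comul =
      (LinearMap.toSpanSingleton k H 1) ∘ₗ counit := by
    ext x; simp [hg]
  rw [h3, LinearMap.lTensor_comp, LinearMap.comp_apply, h2]
  simp

lemma crossAct_cancel_left (M N : LRBimodule.{u, v, w} k H) (a c : H) (s : H ⊗[k] M)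
    (t : N ⊗[k] H) :
    crossAct M N (LinearMap.rTensor M (antipodeInv k H) (LinearMap.lTensor H (M.ract (op c)) s) ⊗ₜ
      LinearMap.lTensor N (antipodeInv k H) (LinearMap.rTensor H (N.lact a) t)) =
    crossAct M N (lcancelMap M (LinearMap.mul' k H ∘ₗ LinearMap.rTensor H (antipodeInv k H)) (a ⊗ₜ s) ⊗ₜ
      rcancelMap N (LinearMap.mul' k H ∘ₗ LinearMap.lTensor H (antipodeInv k H)) (t ⊗ₜ c)) := by
  induction s with
  | zero => simp only [TensorProduct.zero_tmul, TensorProduct.tmul_zero, map_zero]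
  | add x y hx hy => simp only [TensorProduct.add_tmul, TensorProduct.tmul_add, map_add, hx, hy]
  | tmul a' m' =>
    induction t with
    | zero => simp only [TensorProduct.zero_tmul, TensorProduct.tmul_zero, map_zero]
    | add x y hx hy =>
      simp only [TensorProduct.add_tmul, TensorProduct.tmul_add, map_add, hx, hy]
    | tmul n' c' =>
      simp only [LinearMap.lTensor_tmul, LinearMap.rTensor_tmul, lcancelMap_tmul, rcancelMap_tmul,
        crossAct_tmul, LinearMap.comp_apply, LinearMap.mul'_apply, op_mul, map_mul,
        Module.End.mul_apply]

lemma crossAct_cancel_right (M N : LRBimodule.{u, v, w} k H) (a c : H) (s : H ⊗[k] M)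
    (t : N ⊗[k] H) :
    crossAct M N (LinearMap.lTensor H (M.ract (op (antipodeInv k H c))) s ⊗ₜ
      LinearMap.rTensor H (N.lact (antipodeInv k H a)) t) =
    crossAct M N (lcancelMap M (LinearMap.mul' k H ∘ₗ LinearMap.lTensor H (antipodeInv k H)) (a ⊗ₜ s) ⊗ₜ
      rcancelMap N (LinearMap.mul' k H ∘ₗ LinearMap.rTensor H (antipodeInv k H)) (t ⊗ₜ c)) := by
  induction s with
  | zero => simp only [TensorProduct.zero_tmul, TensorProduct.tmul_zero, map_zero]
  | add x y hx hy => simp only [TensorProduct.add_tmul, TensorProduct.tmul_add, map_add, hx, hy]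
  | tmul a' m' =>
    induction t with
    | zero => simp only [TensorProduct.zero_tmul, TensorProduct.tmul_zero, map_zero]
    | add x y hx hy =>
      simp only [TensorProduct.add_tmul, TensorProduct.tmul_add, map_add, hx, hy]
    | tmul n' c' =>
      simp only [LinearMap.lTensor_tmul, LinearMap.rTensor_tmul, lcancelMap_tmul, rcancelMap_tmul,
        crossAct_tmul, LinearMap.comp_apply, LinearMap.mul'_apply, op_mul, map_mul,
        Module.End.mul_apply]

lemma braidingInv_crossAct (M N : LRBimodule.{u, v, w} k H) (p : H ⊗[k] M) (q : N ⊗[k] H) :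
    braidingInv M N (crossAct M N (p ⊗ₜ q)) = TensorProduct.comm k N M (crossAct M N (
      lcancelMap M (LinearMap.mul' k H ∘ₗ LinearMap.rTensor H (antipodeInv k H)) (LinearMap.lTensor H M.lcoact p) ⊗ₜ
      rcancelMap N (LinearMap.mul' k H ∘ₗ LinearMap.lTensor H (antipodeInv k H)) (LinearMap.rTensor H N.rcoact q))) := by
  induction p with
  | zero => simp only [TensorProduct.zero_tmul, map_zero]
  | add x y hx hy => simp only [TensorProduct.add_tmul, map_add, hx, hy]
  | tmul a m =>
    induction q with
    | zero => simp only [TensorProduct.tmul_zero, map_zero]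
    | add x y hx hy => simp only [TensorProduct.tmul_add, map_add, hx, hy]
    | tmul n c =>
      rw [crossAct_tmul, LinearMap.lTensor_tmul, LinearMap.rTensor_tmul, ← crossAct_cancel_left,
        ← M.long_right, ← N.long_left, braidingInv_tmul]

lemma braidingHom_crossAct (M N : LRBimodule.{u, v, w} k H) (p : H ⊗[k] M) (q : N ⊗[k] H) :
    braidingHom M N (TensorProduct.comm k N M (crossAct M N
      (LinearMap.rTensor M (antipodeInv k H) p ⊗ₜ LinearMap.lTensor N (antipodeInv k H) q))) =
    crossAct M N (
      lcancelMap M (LinearMap.mul' k H ∘ₗ LinearMap.lTensor H (antipodeInv k H)) (LinearMap.lTensor H M.lcoact p) ⊗ₜ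
      rcancelMap N (LinearMap.mul' k H ∘ₗ LinearMap.rTensor H (antipodeInv k H)) (LinearMap.rTensor H N.rcoact q)) := by
  induction p with
  | zero => simp only [TensorProduct.zero_tmul, map_zero]
  | add x y hx hy => simp only [TensorProduct.add_tmul, map_add, hx, hy]
  | tmul a m =>
    induction q with
    | zero => simp only [TensorProduct.tmul_zero, map_zero]
    | add x y hx hy => simp only [TensorProduct.tmul_add, map_add, hx, hy]
    | tmul n c =>
      rw [LinearMap.rTensor_tmul, LinearMap.lTensor_tmul, LinearMap.lTensor_tmul,
        LinearMap.rTensor_tmul, ← crossAct_cancel_right, ← M.long_right, ← N.long_left,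
        crossAct_tmul, TensorProduct.comm_tmul, braidingHom_tmul]

lemma crossAct_one (M N : LRBimodule.{u, v, w} k H) (m : M) (n : N) :
    crossAct M N ((1 ⊗ₜ m) ⊗ₜ (n ⊗ₜ 1)) = n ⊗ₜ m := by
  rw [crossAct_tmul, op_one, map_one, map_one, Module.End.one_apply, Module.End.one_apply]

lemma braidingInv_comp_braidingHom (M N : LRBimodule.{u, v, w} k H) :
    braidingInv M N ∘ₗ braidingHom M N = LinearMap.id := by
  refine TensorProduct.ext' fun m n => ?_
  rw [LinearMap.comp_apply, braidingHom_tmul, braidingInv_crossAct,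
    lcoact_cancel M _ mul_antipodeInv_comul, rcoact_cancel N _ mul_antipodeInv_comul',
    crossAct_one, TensorProduct.comm_tmul, LinearMap.id_apply]

lemma braidingHom_comp_braidingInv (M N : LRBimodule.{u, v, w} k H) :
    braidingHom M N ∘ₗ braidingInv M N = LinearMap.id := by
  refine TensorProduct.ext' fun n m => ?_
  rw [LinearMap.comp_apply, braidingInv_tmul, braidingHom_crossAct,
    lcoact_cancel M _ mul_antipodeInv_comul', rcoact_cancel N _ mul_antipodeInv_comul,
    crossAct_one, LinearMap.id_apply]

variable (k H) in
/-- The canonical braiding `c_{M,N} : M ⊗ N → N ⊗ M` of `LR(H)`, given by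
`m ⊗ n ↦ m₍₋₁₎ · n_{<0>} ⊗ m₍₀₎ · n_{<1>}`, with inverse
`n ⊗ m ↦ m₍₀₎ · S⁻¹(n_{<1>}) ⊗ S⁻¹(m₍₋₁₎) · n_{<0>}`. -/
noncomputable def canonicalBraiding (M N : LRBimodule.{u, v, w} k H) : M ⊗[k] N ≃ₗ[k] N ⊗[k] M :=
  LinearEquiv.ofLinearMap (braidingHom M N) (braidingInv M N) (braidingHom_comp_braidingInv M N)
    (braidingInv_comp_braidingHom M N)

end Hopf
end LRBimodule

/-! Expanded along a basis of `H`, the braiding acts on one factor by an operator "left action after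
a coordinate of the right coaction", and on the other by an operator "right action after a
coordinate of the left coaction". The inverse braiding has the same shape, with `S⁻¹` applied to the
acting elements. In both sides of the pseudosymmetry identity each of the three spaces receives one
operator of each kind, and the two sides differ only in the order in which these are applied. So it
suffices that the two kinds commute. Two of the four commutations needed are bimodule and bicomodule
axioms. The other two (left action with left coaction, right action with right coaction) hold when
`H` is commutative and cocommutative: the Yetter–Drinfeld conditions then become Long conditions,
after a cancellation by the antipode (`lcoact_lact`, `rcoact_ract`).

Conversely, the identity is tested on two left-left Yetter–Drinfeld structures on `H`, with trivial
right structures: `regular` (multiplication, with coaction `h ↦ h₁ S(h₃) ⊗ h₂`) and `adjointObj`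
(adjoint action, with comultiplication). The unit of `regular` is coinvariant, so it braids past
everything trivially when it is the left factor and the right coaction of the other element is
trivial. The inverse braiding sends `1 ⊗ z` to `z₂ ⊗ S⁻¹(z₁)`.

On `1 ⊗ 1 ⊗ z` in `regular ⊗ regular ⊗ adjointObj`, applying `ε` to the `adjointObj` factor leaves
`1 ⊗ x = x₁ S(x₃) ⊗ x₂` for `x = S⁻¹(z)`. On `1 ⊗ y ⊗ z` in `regular ⊗ adjointObj ⊗ adjointObj`,
applying `ε` to both `adjointObj` factors and `S` to the last one leaves `ε(y) z = y₁ z S(y₂)`.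
Convolving away the antipode turns these into cocommutativity and commutativity. -/

namespace LRBimodule
-- Yetter–Drinfeld conditions over a commutative and cocommutative `H`.
section
variable {k : Type u} {H : Type v} [Field k] [Ring H] [HopfAlgebra k H]

/-- Right convolution with an action of `H` is injective, since the antipode inverts it. -/
lemma eq_of_sum_antiAction_eq {V : Type*} [AddCommGroup V] [Module k V]
    (ρ : H →ₗ[k] Module.End k V) (hone : ρ 1 = 1) (hmul : ∀ a b, ρ (a * b) = ρ b * ρ a)
    (F G : H →ₗ[k] V)
    (h : ∀ x : H, ∑ i ∈ (ℛ k x).index, ρ ((ℛ k x).right i) (F ((ℛ k x).left i)) =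
      ∑ i ∈ (ℛ k x).index, ρ ((ℛ k x).right i) (G ((ℛ k x).left i))) : F = G := by
  -- Since `ρ` reverses products, `ρ(S(x₃)) ρ(x₂) F(x₁) = ρ(x₂ S(x₃)) F(x₁) = F(x)`, so `F` is
  -- recovered from its convolution with `ρ`.
  have key : ∀ (F : H →ₗ[k] V) (x : H), F x = ∑ i ∈ (ℛ k x).index,
      ρ (antipode k ((ℛ k x).right i)) (∑ j ∈ (ℛ k ((ℛ k x).left i)).index,
        ρ ((ℛ k ((ℛ k x).left i)).right j) (F ((ℛ k ((ℛ k x).left i)).left j))) := by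
    intro F x
    let T : H ⊗[k] (H ⊗[k] H) →ₗ[k] V := TensorProduct.lift
      ((LinearMap.flip (ρ ∘ₗ LinearMap.mul' k H ∘ₗ LinearMap.lTensor H (antipode k))).comp F)
    have hT : ∀ a b c, T (a ⊗ₜ (b ⊗ₜ c)) = ρ (antipode k c) (ρ b (F a)) := by
      intro a b c; simp [T, hmul]
    have h2 := congrArg T (sum_tmul_tmul_eq (ℛ k x) (fun i => ℛ k ((ℛ k x).left i))
      (fun i => ℛ k ((ℛ k x).right i)))
    simp only [map_sum, hT] at h2
    simp only [map_sum]
    rw [h2]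
    simp only [← Module.End.mul_apply, ← hmul]
    simp only [← LinearMap.sum_apply, ← map_sum, sum_mul_antipode_eq_smul]
    simp only [map_smul, hone, LinearMap.smul_apply, Module.End.one_apply]
    simp only [← map_smul, ← map_sum]
    have := congrArg (TensorProduct.rid k H) (sum_tmul_counit_eq (ℛ k x))
    simp only [map_sum, TensorProduct.rid_tmul, one_smul] at this
    rw [this]
  ext x
  rw [key F, key G]
  simp only [h]

/-- By cocommutativity and commutativity the right side `h₁ m₍₋₁₎ ⊗ h₂ · m₍₀₎` of the
Yetter–Drinfeld condition equals `m₍₋₁₎ h₂ ⊗ h₁ · m₍₀₎`. Both sides are then convolutions with right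
multiplication by `h₂`, which the antipode cancels. -/
lemma lcoact_lact [IsCocomm k H] (hcomm : ∀ a b : H, a * b = b * a) (M : LRBimodule.{u, v, w} k H)
    (h : H) (m : M) : M.lcoact (M.lact h m) = LinearMap.lTensor H (M.lact h) (M.lcoact m) := by
  let ρ : H →ₗ[k] Module.End k (H ⊗[k] M) :=
    LinearMap.rTensorHom M ∘ₗ (LinearMap.mul k H).flip
  have hρ : ∀ a, ρ a = LinearMap.rTensor M (LinearMap.mulRight k a) := fun a => rfl
  refine LinearMap.congr_fun (eq_of_sum_antiAction_eq ρ ?_ ?_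
    (M.lcoact ∘ₗ M.lact.toLinearMap.flip m)
    ((LinearMap.lTensorHom H ∘ₗ M.lact.toLinearMap).flip (M.lcoact m)) ?_) h
  · rw [hρ]; simp [Module.End.one_eq_id]
  · intro a b
    simp only [hρ]
    ext; simp [mul_assoc]
  · intro x
    have h1 := M.yd_left x m (ℛ k x)
    -- Cocommutativity, in the form that the two legs of `Δ(x)` may be exchanged in any bilinear
    -- expression.
    have hc : ∀ (B : H →ₗ[k] H →ₗ[k] H ⊗[k] M),
        ∑ i ∈ (ℛ k x).index, B ((ℛ k x).left i) ((ℛ k x).right i) =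
        ∑ i ∈ (ℛ k x).index, B ((ℛ k x).right i) ((ℛ k x).left i) := by
      intro B
      have := congrArg (TensorProduct.lift B) (comm_comul k x)
      rw [← (ℛ k x).eq] at this
      simpa using this.symm
    simp only [hρ]
    refine h1.trans ?_
    have := hc (((TensorProduct.mapBilinear (RingHom.id k) H M H M).compl₁₂ (LinearMap.mul k H)
      M.lact.toLinearMap).compr₂ (LinearMap.applyₗ (M.lcoact m)))
    refine this.trans (Finset.sum_congr rfl fun i _ => ?_)
    have e : LinearMap.mulLeft k ((ℛ k x).right i) = LinearMap.mulRight k ((ℛ k x).right i) := by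
      ext a; simp [hcomm a]
    change TensorProduct.map (LinearMap.mulLeft k _) (M.lact _) _ =
      LinearMap.rTensor M (LinearMap.mulRight k _) (LinearMap.lTensor H (M.lact _) (M.lcoact m))
    rw [e]
    exact (LinearMap.congr_fun (LinearMap.rTensor_comp_lTensor ..) _).symm

/-- Mirror image of `lcoact_lact`; here the legs are exchanged on the side of the Yetter–Drinfeld
condition that contains the coaction of `m · h₂`. -/
lemma rcoact_ract [IsCocomm k H] (hcomm : ∀ a b : H, a * b = b * a) (M : LRBimodule.{u, v, w} k H)
    (h : H) (m : M) :
    M.rcoact (M.ract (op h) m) = LinearMap.rTensor H (M.ract (op h)) (M.rcoact m) := by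
  let ρ : H →ₗ[k] Module.End k (M ⊗[k] H) :=
    LinearMap.lTensorHom M ∘ₗ LinearMap.mul k H
  let R : H →ₗ[k] Module.End k M := M.ract.toLinearMap ∘ₗ (opLinearEquiv k).toLinearMap
  have hρ : ∀ a, ρ a = LinearMap.lTensor M (LinearMap.mulLeft k a) := fun a => rfl
  refine LinearMap.congr_fun (eq_of_sum_antiAction_eq ρ ?_ ?_
    (M.rcoact ∘ₗ R.flip m)
    ((LinearMap.rTensorHom H ∘ₗ R).flip (M.rcoact m)) ?_) h
  · rw [hρ]; simp [Module.End.one_eq_id]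
  · intro a b
    simp only [hρ]
    -- Left multiplication reverses products only because `H` is commutative.
    ext; simp [hcomm a b]
  · intro x
    have h1 := M.yd_right x m (ℛ k x)
    have hc : ∀ (B : H →ₗ[k] H →ₗ[k] M ⊗[k] H),
        ∑ i ∈ (ℛ k x).index, B ((ℛ k x).left i) ((ℛ k x).right i) =
        ∑ i ∈ (ℛ k x).index, B ((ℛ k x).right i) ((ℛ k x).left i) := by
      intro B
      have := congrArg (TensorProduct.lift B) (comm_comul k x)
      rw [← (ℛ k x).eq] at this
      simpa using this.symm
    simp only [hρ]
    have := hc ((LinearMap.lTensorHom M ∘ₗ LinearMap.mul k H).compl₂ (M.rcoact ∘ₗ R.flip m))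
    refine this.symm.trans (h1.trans (Finset.sum_congr rfl fun i _ => ?_))
    have e : LinearMap.mulRight k ((ℛ k x).right i) = LinearMap.mulLeft k ((ℛ k x).right i) := by
      ext a; simp [hcomm a]
    change _ = LinearMap.lTensor M (LinearMap.mulLeft k _)
      (LinearMap.rTensor H (M.ract (op _)) (M.rcoact m))
    rw [e]
    exact (LinearMap.congr_fun (LinearMap.lTensor_comp_rTensor ..) _).symm
end
end LRBimodule

/-! ### Coactions in coordinates. -/

namespace LRBimodule
section
variable {k : Type u} {H : Type v} [Field k] [Ring H] [HopfAlgebra k H]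

/-- The coordinate `f(m₍₋₁₎) m₍₀₎` of the left coaction along `f : H → k`. -/
noncomputable def lcoord (M : LRBimodule.{u, v, w} k H) (f : Module.Dual k H) : Module.End k M :=
  (TensorProduct.lid k M).toLinearMap ∘ₗ LinearMap.rTensor M f ∘ₗ M.lcoact

/-- The coordinate `f(m_{<1>}) m_{<0>}` of the right coaction along `f : H → k`. -/
noncomputable def rcoord (M : LRBimodule.{u, v, w} k H) (f : Module.Dual k H) : Module.End k M :=
  (TensorProduct.rid k M).toLinearMap ∘ₗ LinearMap.lTensor M f ∘ₗ M.rcoact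

/-- This replaces coactions by families of endomorphisms of `M`, so that identities between
braidings become commutation relations between operators. -/
lemma lcoact_eq_sum {ι : Type*} [Fintype ι] (b : Module.Basis ι k H)
    (M : LRBimodule.{u, v, w} k H) (m : M) :
    M.lcoact m = ∑ i, b i ⊗ₜ M.lcoord (b.coord i) m := by
  have : ∀ t : H ⊗[k] M, t = ∑ i, b i ⊗ₜ TensorProduct.lid k M (LinearMap.rTensor M (b.coord i) t) := by
    intro t
    induction t with
    | zero => simp
    | add x y hx hy =>
      conv_lhs => rw [hx, hy]
      simp only [map_add, TensorProduct.tmul_add, Finset.sum_add_distrib]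
    | tmul a n =>
      simp only [LinearMap.rTensor_tmul, TensorProduct.lid_tmul, ← TensorProduct.smul_tmul,
        ← TensorProduct.sum_tmul]
      congr 1
      exact (b.sum_repr a).symm
  exact this _

lemma rcoact_eq_sum {ι : Type*} [Fintype ι] (b : Module.Basis ι k H)
    (M : LRBimodule.{u, v, w} k H) (m : M) :
    M.rcoact m = ∑ i, M.rcoord (b.coord i) m ⊗ₜ b i := by
  have : ∀ t : M ⊗[k] H, t = ∑ i, TensorProduct.rid k M (LinearMap.lTensor M (b.coord i) t) ⊗ₜ b i := by
    intro t
    induction t with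
    | zero => simp
    | add x y hx hy =>
      conv_lhs => rw [hx, hy]
      simp only [map_add, TensorProduct.add_tmul, Finset.sum_add_distrib]
    | tmul n a =>
      simp only [LinearMap.lTensor_tmul, TensorProduct.rid_tmul, TensorProduct.smul_tmul,
        ← TensorProduct.tmul_sum]
      congr 1
      exact (b.sum_repr a).symm
  exact this _

/-- Apply `f` and `g` to the outer legs of the bicomodule compatibility. -/
lemma lcoord_rcoord (M : LRBimodule.{u, v, w} k H) (f g : Module.Dual k H) (m : M) :
    M.lcoord f (M.rcoord g m) = M.rcoord g (M.lcoord f m) := by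
  have h := LinearMap.congr_fun M.lcoact_rcoact m
  have hl : ∀ t : M ⊗[k] H, M.lcoord f (TensorProduct.rid k M (LinearMap.lTensor M g t)) =
      TensorProduct.lid k M (TensorProduct.map f ((TensorProduct.rid k M).toLinearMap ∘ₗ
        LinearMap.lTensor M g) (TensorProduct.assoc k H M H (LinearMap.rTensor H M.lcoact t))) := by
    intro t
    induction t with
    | zero => simp
    | add x y hx hy => simp only [map_add, hx, hy]
    | tmul n a =>
      simp only [LinearMap.lTensor_tmul, LinearMap.rTensor_tmul, TensorProduct.rid_tmul, map_smul,
        lcoord, LinearMap.comp_apply]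
      induction M.lcoact n with
      | zero => simp
      | add x y hx hy => simp only [map_add, smul_add, hx, hy, TensorProduct.add_tmul]
      | tmul c n' => simp [smul_comm (g a)]
  have hr : ∀ t : H ⊗[k] M, M.rcoord g (TensorProduct.lid k M (LinearMap.rTensor M f t)) =
      TensorProduct.lid k M (TensorProduct.map f ((TensorProduct.rid k M).toLinearMap ∘ₗ
        LinearMap.lTensor M g) (LinearMap.lTensor H M.rcoact t)) := by
    intro t
    induction t with
    | zero => simp
    | add x y hx hy => simp only [map_add, hx, hy]
    | tmul a n => simp [rcoord]
  exact (hl _).trans ((congrArg _ (congrArg _ h)).trans (hr _).symm)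

lemma lcoord_lact [IsCocomm k H] (hcomm : ∀ a b : H, a * b = b * a) (M : LRBimodule.{u, v, w} k H)
    (f : Module.Dual k H) (h : H) (m : M) :
    M.lcoord f (M.lact h m) = M.lact h (M.lcoord f m) := by
  simp only [lcoord, LinearMap.comp_apply, lcoact_lact hcomm]
  induction M.lcoact m with
  | zero => simp
  | add x y hx hy => simp only [map_add, hx, hy]
  | tmul a n => simp

lemma rcoord_ract [IsCocomm k H] (hcomm : ∀ a b : H, a * b = b * a) (M : LRBimodule.{u, v, w} k H)
    (f : Module.Dual k H) (h : H) (m : M) :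
    M.rcoord f (M.ract (op h) m) = M.ract (op h) (M.rcoord f m) := by
  simp only [rcoord, LinearMap.comp_apply, rcoact_ract hcomm]
  induction M.rcoact m with
  | zero => simp
  | add x y hx hy => simp only [map_add, hx, hy]
  | tmul n a => simp

/-- The two kinds of operator produced by the braiding commute: each constituent of one commutes
with each constituent of the other. -/
lemma ract_lcoord_lact_rcoord [IsCocomm k H] (hcomm : ∀ a b : H, a * b = b * a)
    (M : LRBimodule.{u, v, w} k H) (f g : Module.Dual k H) (h h' : H) (m : M) :
    M.ract (op h) (M.lcoord f (M.lact h' (M.rcoord g m))) =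
      M.lact h' (M.rcoord g (M.ract (op h) (M.lcoord f m))) := by
  rw [lcoord_lact hcomm, ← M.lact_ract, lcoord_rcoord, rcoord_ract hcomm]

end

/-! ### Sufficiency of commutativity and cocommutativity. -/

section
variable {k : Type u} {H : Type v} [Field k] [Ring H] [HopfAlgebra k H] [FiniteDimensional k H]

lemma canonicalBraiding_tmul {ι : Type*} [Fintype ι] (b : Module.Basis ι k H)
    (M N : LRBimodule.{u, v, w} k H) (m : M) (n : N) :
    canonicalBraiding k H M N (m ⊗ₜ n) = ∑ p : ι × ι,
      N.lact (b p.1) (N.rcoord (b.coord p.2) n) ⊗ₜ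
        M.ract (op (b p.2)) (M.lcoord (b.coord p.1) m) := by
  change braidingHom M N (m ⊗ₜ n) = _
  rw [braidingHom_tmul, lcoact_eq_sum b, rcoact_eq_sum b]
  simp only [TensorProduct.sum_tmul, TensorProduct.tmul_sum, map_sum, crossAct_tmul]
  rw [Fintype.sum_prod_type, Finset.sum_comm]

lemma canonicalBraiding_symm_tmul {ι : Type*} [Fintype ι] (b : Module.Basis ι k H)
    (M N : LRBimodule.{u, v, w} k H) (m : M) (n : N) :
    (canonicalBraiding k H M N).symm (n ⊗ₜ m) = ∑ p : ι × ι,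
      M.ract (op (antipodeInv k H (b p.2))) (M.lcoord (b.coord p.1) m) ⊗ₜ
        N.lact (antipodeInv k H (b p.1)) (N.rcoord (b.coord p.2) n) := by
  change braidingInv M N (n ⊗ₜ m) = _
  rw [braidingInv_tmul, lcoact_eq_sum b, rcoact_eq_sum b]
  simp only [TensorProduct.sum_tmul, TensorProduct.tmul_sum, map_sum, LinearMap.rTensor_tmul,
    LinearMap.lTensor_tmul, crossAct_tmul, TensorProduct.comm_tmul]
  rw [Fintype.sum_prod_type, Finset.sum_comm]

theorem isPseudosymmetric_of_comm_of_isCocomm [IsCocomm k H] (hcomm : ∀ a b : H, a * b = b * a) :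
    IsPseudosymmetric (canonicalBraiding.{u, v, w} k H) := by
  intro X Y Z
  let b := Module.finBasis k H
  refine TensorProduct.ext_threefold fun x y z => ?_
  -- Both sides become triple sums of pure tensors, and `ract_lcoord_lact_rcoord` brings the
  -- operators on every factor to one common order.
  simp only [LinearMap.comp_apply, LinearEquiv.coe_coe, LinearMap.rTensor_tmul,
    LinearMap.lTensor_tmul, canonicalBraiding_tmul b, canonicalBraiding_symm_tmul b,
    TensorProduct.sum_tmul, TensorProduct.tmul_sum, map_sum, TensorProduct.assoc_tmul,
    TensorProduct.assoc_symm_tmul, ract_lcoord_lact_rcoord hcomm]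
  -- The summands now agree; only the order of the three summations differs.
  rw [Finset.sum_comm]
  rw [Finset.sum_congr rfl fun _ _ => Finset.sum_comm, Finset.sum_comm]
end
end LRBimodule

/-! ### Maps compatible with the convolution product. -/

section Convolution
open WithConv
variable {k C A B : Type*} [CommSemiring k] [AddCommMonoid C] [Module k C] [Coalgebra k C]
  [Semiring A] [Algebra k A] [Semiring B] [Algebra k B]

lemma WithConv.algHom_convMul (φ : A →ₐ[k] B) (f g : WithConv (C →ₗ[k] A)) :
    toConv (φ.toLinearMap ∘ₗ (f * g).ofConv) =
      toConv (φ.toLinearMap ∘ₗ f.ofConv) * toConv (φ.toLinearMap ∘ₗ g.ofConv) := by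
  ext x
  simp [(ℛ k x).convMul_apply, map_sum]

/-- Serves for maps such as `id ⊗ δ`, which are not multiplicative but are linear over the first
tensor factor. -/
lemma WithConv.comp_convMul_of_left (T : A →ₗ[k] B) (f : C →ₗ[k] A) (f' : C →ₗ[k] B)
    (h : ∀ c t, T (f c * t) = f' c * T t) (g : WithConv (C →ₗ[k] A)) :
    toConv (T ∘ₗ (toConv f * g).ofConv) = toConv f' * toConv (T ∘ₗ g.ofConv) := by
  ext x
  simp [(ℛ k x).convMul_apply, map_sum, h]

lemma WithConv.comp_convMul_of_right (T : A →ₗ[k] B) (f : C →ₗ[k] A) (f' : C →ₗ[k] B)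
    (h : ∀ c t, T (t * f c) = T t * f' c) (g : WithConv (C →ₗ[k] A)) :
    toConv (T ∘ₗ (g * toConv f).ofConv) = toConv (T ∘ₗ g.ofConv) * toConv f' := by
  ext x
  simp [(ℛ k x).convMul_apply, map_sum, h]
end Convolution

/-! ### The coadjoint coaction and the adjoint action. -/

namespace HopfAlgebra
open WithConv
section
variable {k H A : Type*} [Field k] [Ring H] [HopfAlgebra k H] [Ring A] [Algebra k A]

lemma algHom_mul_algHom_antipode (φ : H →ₐ[k] A) :
    toConv φ.toLinearMap * toConv (φ.toLinearMap ∘ₗ antipode k) = 1 := by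
  ext x
  rw [(ℛ k x).convMul_apply]
  simp [← map_mul, ← map_sum, sum_mul_antipode_eq_smul, Algebra.algebraMap_eq_smul_one]

lemma algHom_antipode_mul_algHom (φ : H →ₐ[k] A) :
    toConv (φ.toLinearMap ∘ₗ antipode k) * toConv φ.toLinearMap = 1 := by
  ext x
  rw [(ℛ k x).convMul_apply]
  simp [← map_mul, ← map_sum, sum_antipode_mul_eq_smul, Algebra.algebraMap_eq_smul_one]

/-- Composing an algebra map with `S` gives its convolution inverse, and the inverse of a product is
the reversed product of the inverses. -/
lemma algHom_antipode_of_eq_mul (φ ψ χ : H →ₐ[k] A)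
    (h : toConv χ.toLinearMap = toConv φ.toLinearMap * toConv ψ.toLinearMap) :
    toConv (χ.toLinearMap ∘ₗ antipode k) =
      toConv (ψ.toLinearMap ∘ₗ antipode k) * toConv (φ.toLinearMap ∘ₗ antipode k) := by
  refine left_inv_eq_right_inv (algHom_antipode_mul_algHom χ) ?_
  rw [h, mul_assoc, ← mul_assoc (toConv ψ.toLinearMap), algHom_mul_algHom_antipode, one_mul,
    algHom_mul_algHom_antipode]

variable (k H) in
/-- The coadjoint coaction `h ↦ h₁ S(h₃) ⊗ h₂`. -/
noncomputable def coadjoint : H →ₗ[k] H ⊗[k] H :=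
  (toConv comul * toConv ((Algebra.TensorProduct.includeLeft (R := k) (S := k) (A := H) (B := H)).toLinearMap ∘ₗ
    antipode k)).ofConv

lemma coadjoint_apply {ι : Type*} (x : H) (r : Repr k x ι) :
    coadjoint k H x = ∑ i ∈ r.index, comul (r.left i) * (antipode k (r.right i) ⊗ₜ 1) := by
  change (toConv comul * toConv _ : WithConv (H →ₗ[k] H ⊗[k] H)) x = _
  rw [r.convMul_apply]
  simp

lemma coadjoint_one : coadjoint k H 1 = 1 ⊗ₜ 1 := by
  change (toConv comul * toConv _ : WithConv (H →ₗ[k] H ⊗[k] H)) 1 = _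
  simp [Algebra.TensorProduct.one_def]

/-- With `P` and `Q` the inclusions of the two tensor factors, `Δ = P * Q`; the coadjoint coaction
is thus the conjugate `P * Q * P⁻¹`. -/
lemma toConv_comul :
    (toConv comul : WithConv (H →ₗ[k] H ⊗[k] H)) =
      toConv (Algebra.TensorProduct.includeLeft (R := k) (S := k) (A := H) (B := H)).toLinearMap *
      toConv (Algebra.TensorProduct.includeRight (R := k) (A := H) (B := H)).toLinearMap := by
  ext x
  rw [(ℛ k x).convMul_apply]
  simp [(ℛ k x).eq]

lemma coadjoint_comul_counit (x : H) :
    LinearMap.rTensor H (counit (R := k)) (coadjoint k H x) = 1 ⊗ₜ x := by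
  have h : ∀ a b : H, LinearMap.rTensor H (counit (R := k)) (comul a * (b ⊗ₜ 1)) =
      1 ⊗ₜ (counit (R := k) b • a) := by
    intro a b
    rw [← (ℛ k a).eq]
    simp only [Finset.sum_mul, map_sum, Algebra.TensorProduct.tmul_mul_tmul, mul_one,
      LinearMap.rTensor_tmul, Bialgebra.counit_mul]
    have : ∀ i, (counit (R := k) ((ℛ k a).left i) * counit b) ⊗ₜ[k] (ℛ k a).right i =
       1 ⊗ₜ (counit (R := k) b • (counit (R := k) ((ℛ k a).left i) • (ℛ k a).right i)) := by
      intro i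
      rw [smul_smul, ← TensorProduct.smul_tmul, smul_eq_mul, mul_one, mul_comm]
    simp only [this, ← TensorProduct.tmul_sum, ← Finset.smul_sum, sum_counit_smul]
  rw [coadjoint_apply x (ℛ k x)]
  simp only [map_sum, h, counit_antipode, ← TensorProduct.tmul_sum]
  congr 1
  have := congrArg (TensorProduct.rid k H) (sum_tmul_counit_eq (ℛ k x))
  simpa only [map_sum, TensorProduct.rid_tmul, one_smul] using this

/-- Write `δ` for the coadjoint coaction; both sides equal the convolution product `k₁ * (J ∘ δ) *
k₁⁻¹`. On the left, `F` is an algebra map with `F ∘ Δ = k₁ * (J ∘ Δ)` and `F ∘ P = k₁ * (J ∘ P)`,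
and inverting the latter supplies the right-hand factors. On the right, `id ⊗ δ` is linear over the
first leg, so it carries `P * Q * P⁻¹` to the same product. -/
lemma coadjoint_coassoc :
    (TensorProduct.assoc k H H H).toLinearMap ∘ₗ LinearMap.rTensor H comul ∘ₗ coadjoint k H =
      LinearMap.lTensor H (coadjoint k H) ∘ₗ coadjoint k H := by
  let P := Algebra.TensorProduct.includeLeft (R := k) (S := k) (A := H) (B := H)
  let Q := Algebra.TensorProduct.includeRight (R := k) (A := H) (B := H)
  let k₁ := Algebra.TensorProduct.includeLeft (R := k) (S := k) (A := H) (B := H ⊗[k] H)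
  let J := Algebra.TensorProduct.includeRight (R := k) (A := H) (B := H ⊗[k] H)
  let F : H ⊗[k] H →ₐ[k] H ⊗[k] (H ⊗[k] H) :=
    (Algebra.TensorProduct.assoc k k k H H H).toAlgHom.comp
      (Algebra.TensorProduct.map (Bialgebra.comulAlgHom k H) (AlgHom.id k H))
  have hF : F.toLinearMap = (TensorProduct.assoc k H H H).toLinearMap ∘ₗ
      LinearMap.rTensor H comul := by
    ext; rfl
  have hFcomul : toConv (F.toLinearMap ∘ₗ comul) =
      toConv k₁.toLinearMap * toConv (J.toLinearMap ∘ₗ comul) := by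
    rw [hF]
    ext x
    rw [(ℛ k x).convMul_apply]
    simp only [LinearMap.comp_apply, LinearEquiv.coe_coe, coassoc_apply]
    rw [← (ℛ k x).eq]
    simp [k₁, J]
  have hFP : toConv (F.comp P).toLinearMap =
      toConv k₁.toLinearMap * toConv (J.comp P).toLinearMap := by
    ext x
    rw [(ℛ k x).convMul_apply]
    have : F (P x) = TensorProduct.assoc k H H H (comul x ⊗ₜ 1) := rfl
    simp only [AlgHom.toLinearMap_apply, AlgHom.comp_apply, this]
    rw [← (ℛ k x).eq]
    simp [k₁, J, P, TensorProduct.sum_tmul]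
  have hl : toConv (F.toLinearMap ∘ₗ coadjoint k H) = toConv k₁.toLinearMap *
      toConv (J.toLinearMap ∘ₗ coadjoint k H) * toConv (k₁.toLinearMap ∘ₗ antipode k) := by
    rw [coadjoint, algHom_convMul, algHom_convMul]
    have := algHom_antipode_of_eq_mul _ _ _ hFP
    simp only [AlgHom.comp_toLinearMap, LinearMap.comp_assoc] at this
    simp only
    rw [hFcomul, this]
    simp only [mul_assoc]; rfl
  have hr : toConv (LinearMap.lTensor H (coadjoint k H) ∘ₗ coadjoint k H) =
      toConv k₁.toLinearMap *
      toConv (J.toLinearMap ∘ₗ coadjoint k H) * toConv (k₁.toLinearMap ∘ₗ antipode k) := by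
    have hδ : coadjoint k H = (toConv P.toLinearMap * toConv Q.toLinearMap *
        toConv (P.toLinearMap ∘ₗ antipode k)).ofConv := by
      rw [← toConv_comul]; rfl
    have hQ : LinearMap.lTensor H (coadjoint k H) ∘ₗ Q.toLinearMap =
        J.toLinearMap ∘ₗ coadjoint k H := by
      ext; rfl
    conv_lhs => rw [congrArg (LinearMap.comp (LinearMap.lTensor H (coadjoint k H))) hδ]
    rw [comp_convMul_of_right _ _ (k₁.toLinearMap ∘ₗ antipode k),
      comp_convMul_of_left _ _ k₁.toLinearMap, ofConv_toConv, hQ]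
    · intro c t
      induction t with
      | zero => simp
      | add x y hx hy => simp only [map_add, mul_add, hx, hy]
      | tmul a b => simp [k₁, P]
    · intro c t
      induction t with
      | zero => simp
      | add x y hx hy => simp only [map_add, add_mul, hx, hy]
      | tmul a b => simp [k₁, P]
  rw [← LinearMap.comp_assoc, ← hF]
  exact toConv_injective (hl.trans hr.symm)

lemma rTensor_mulRight_apply (a : H) (t : H ⊗[k] H) :
    LinearMap.rTensor H (LinearMap.mulRight k a) t =
      t * Algebra.TensorProduct.includeLeft (R := k) (S := k) (A := H) (B := H) a := by
  induction t with
  | zero => simp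
  | add x y hx hy => simp only [map_add, add_mul, hx, hy]
  | tmul a b => simp

/-- The Yetter-Drinfeld condition for left multiplication and the coadjoint coaction. -/
lemma coadjoint_yetterDrinfeld {ι : Type*} (h m : H) (r : Repr k h ι) :
    ∑ i ∈ r.index, LinearMap.rTensor H (LinearMap.mulRight k (r.right i))
        (coadjoint k H (r.left i * m)) =
      ∑ i ∈ r.index, TensorProduct.map (LinearMap.mulLeft k (r.left i))
        (LinearMap.mulLeft k (r.right i)) (coadjoint k H m) := by
  let P := Algebra.TensorProduct.includeLeft (R := k) (S := k) (A := H) (B := H)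
  -- With `δ` the coadjoint coaction, `δ(x m) = Δ(x₁) δ(m) (S(x₂) ⊗ 1)`. Convolving with `P` on the
  -- right removes the antipode and leaves the Yetter–Drinfeld condition.
  have hmul : toConv (coadjoint k H ∘ₗ LinearMap.mulRight k m) =
      toConv (LinearMap.mulRight k (coadjoint k H m) ∘ₗ comul) *
        toConv (P.toLinearMap ∘ₗ antipode k) := by
    ext x
    rw [(ℛ k x).convMul_apply]
    simp only [LinearMap.comp_apply, LinearMap.mulRight_apply,
      AlgHom.toLinearMap_apply]
    rw [coadjoint_apply _ ((ℛ k x).mul (ℛ k m)), coadjoint_apply m (ℛ k m)]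
    simp [Finset.sum_product, Finset.mul_sum, Finset.sum_mul, antipode_mul_antidistrib, P,
      mul_assoc]
  have hL : ∀ (a b : H) (t : H ⊗[k] H), TensorProduct.map (LinearMap.mulLeft k a)
        (LinearMap.mulLeft k b) t = (a ⊗ₜ b) * t := by
    intro a b t
    induction t with
    | zero => simp
    | add x y hx hy => simp only [map_add, mul_add, hx, hy]
    | tmul a b => simp
  have h1 := congr($hmul * toConv P.toLinearMap)
  rw [mul_assoc, algHom_antipode_mul_algHom, mul_one] at h1
  have h2 := congr($h1 h)
  rw [r.convMul_apply] at h2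
  simp only [rTensor_mulRight_apply, hL, ← Finset.sum_mul, r.eq]
  exact h2

/-- The adjoint action `x ↦ (a ↦ x₁ a S(x₂))`. -/
noncomputable def adjointFun (a : H) : WithConv (H →ₗ[k] H) :=
  toConv (LinearMap.mulRight k a) * toConv (antipode k)

lemma adjointFun_apply {ι : Type*} (a x : H) (r : Repr k x ι) :
    adjointFun (k := k) a x = ∑ i ∈ r.index, r.left i * a * antipode k (r.right i) := by
  rw [adjointFun, r.convMul_apply]; simp

variable (k H) in
/-- The adjoint action `x · a = x₁ a S(x₂)` of a Hopf algebra on itself. -/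
noncomputable def adjoint : H →ₐ[k] Module.End k H :=
  AlgHom.ofLinearMap
    (LinearMap.mk₂ k (fun x a => adjointFun (k := k) a x)
      (by simp) (by simp)
      (fun x a b => by simp [adjointFun_apply _ _ (ℛ k x), mul_add, add_mul, Finset.sum_add_distrib])
      (fun c x a => by simp [adjointFun_apply _ _ (ℛ k x), Finset.smul_sum]))
    (by ext; simp [adjointFun, Algebra.TensorProduct.one_def])
    (fun x y => by
      ext a
      simp [adjointFun_apply _ _ (ℛ k x), adjointFun_apply _ _ (ℛ k y),
        adjointFun_apply _ _ ((ℛ k x).mul (ℛ k y)), Finset.sum_product, antipode_mul_antidistrib,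
        mul_assoc]
      exact Finset.sum_comm)

lemma adjoint_apply {ι : Type*} (a x : H) (r : Repr k x ι) :
    adjoint k H x a = ∑ i ∈ r.index, r.left i * a * antipode k (r.right i) :=
  adjointFun_apply a x r

lemma counit_adjoint (x a : H) : counit (R := k) (adjoint k H x a) = counit x * counit a := by
  rw [adjoint_apply a x (ℛ k x)]
  simp only [map_sum, Bialgebra.counit_mul, counit_antipode, mul_right_comm _ (counit a),
    ← Finset.sum_mul]
  congr 1
  simpa using congr(counit (R := k) $(sum_counit_smul (ℛ k x)))

/-- The Yetter-Drinfeld condition for the adjoint action and the comultiplication. -/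
lemma adjoint_yetterDrinfeld {ι : Type*} (h m : H) (r : Repr k h ι) :
    ∑ i ∈ r.index, LinearMap.rTensor H (LinearMap.mulRight k (r.right i))
        (comul (R := k) (adjoint k H (r.left i) m)) =
      ∑ i ∈ r.index, TensorProduct.map (LinearMap.mulLeft k (r.left i))
        (adjoint k H (r.right i)) (comul m) := by
  let P := Algebra.TensorProduct.includeLeft (R := k) (S := k) (A := H) (B := H)
  let Q := Algebra.TensorProduct.includeRight (R := k) (A := H) (B := H)
  have hL : ∀ (a b : H) (t : H ⊗[k] H), TensorProduct.map (LinearMap.mulLeft k a)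
        (adjoint k H b) t = P a * LinearMap.lTensor H (adjoint k H b) t := by
    intro a b t
    induction t with
    | zero => simp
    | add x y hx hy => simp only [map_add, mul_add, hx, hy]
    | tmul a b => simp [P]
  -- `Δ(x · m) = Δ(x₁) Δ(m) Δ(S(x₂))`, where `Δ ∘ S = (Q ∘ S) * (P ∘ S)`. The last factor is
  -- cancelled by convolving with `P` in `key`.
  have hl : toConv (comul ∘ₗ (adjoint k H).toLinearMap.flip m) =
      toConv (LinearMap.mulRight k (comul m) ∘ₗ comul) *
        (toConv (Q.toLinearMap ∘ₗ antipode k) * toConv (P.toLinearMap ∘ₗ antipode k)) := by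
    rw [← algHom_antipode_of_eq_mul P Q (Bialgebra.comulAlgHom k H) toConv_comul]
    ext x
    rw [(ℛ k x).convMul_apply]
    simp [adjoint_apply _ _ (ℛ k x)]
  have hr : ∀ t : H ⊗[k] H, toConv ((LinearMap.lTensorHom H ∘ₗ (adjoint k H).toLinearMap).flip t) =
      toConv (LinearMap.mulRight k t ∘ₗ Q.toLinearMap) * toConv (Q.toLinearMap ∘ₗ antipode k) := by
    intro t
    ext x
    rw [(ℛ k x).convMul_apply]
    change LinearMap.lTensor H (adjoint k H x) t = _
    induction t with
    | zero => simp
    | add a b ha hb =>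
      rw [map_add, ha, hb]
      simp [mul_add, add_mul, Finset.sum_add_distrib]
    | tmul a b => simp [Q, adjoint_apply _ _ (ℛ k x), TensorProduct.tmul_sum]
  have hPQ : ∀ t : H ⊗[k] H, toConv P.toLinearMap * toConv (LinearMap.mulRight k t ∘ₗ Q.toLinearMap) =
      toConv (LinearMap.mulRight k t ∘ₗ comul) := by
    intro t
    ext x
    rw [(ℛ k x).convMul_apply]
    simp [P, Q, ← mul_assoc, ← Finset.sum_mul, (ℛ k x).eq]
  have key : toConv (comul ∘ₗ (adjoint k H).toLinearMap.flip m) * toConv P.toLinearMap =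
      toConv P.toLinearMap *
        toConv ((LinearMap.lTensorHom H ∘ₗ (adjoint k H).toLinearMap).flip (comul m)) := by
    rw [hl, hr, mul_assoc, mul_assoc, algHom_antipode_mul_algHom, mul_one, ← mul_assoc, hPQ]
  have h2 := congr($key h)
  rw [r.convMul_apply, r.convMul_apply] at h2
  simp only [rTensor_mulRight_apply, hL]
  exact h2

/-- The hypothesis says `P * Q * P⁻¹ = Q`, hence `P * Q = Q * P`; the left side is `Δ` and the right
side is `Δ` with its legs exchanged. -/
lemma isCocomm_of_coadjoint_eq (h : ∀ x : H, coadjoint k H x = 1 ⊗ₜ x) : IsCocomm k H := by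
  let P := Algebra.TensorProduct.includeLeft (R := k) (S := k) (A := H) (B := H)
  let Q := Algebra.TensorProduct.includeRight (R := k) (A := H) (B := H)
  have hc : toConv (coadjoint k H) = toConv comul * toConv (P.toLinearMap ∘ₗ antipode k) := rfl
  have hQ : coadjoint k H = Q.toLinearMap := LinearMap.ext h
  have key := congr($hc * toConv P.toLinearMap)
  rw [hQ, mul_assoc, algHom_antipode_mul_algHom, mul_one] at key
  refine ⟨LinearMap.ext fun x => ?_⟩
  have hx := congr($key x)
  rw [(ℛ k x).convMul_apply] at hx
  change _ = comul x at hx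
  rw [← hx, LinearMap.comp_apply, ← (ℛ k x).eq]
  simp [P, Q]

/-- Convolving `x₁ a S(x₂) = ε(x) a` on the right with the identity gives `x a` on one side and `a
x` on the other. -/
lemma commute_of_adjoint_eq (h : ∀ x a : H, adjoint k H x a = counit (R := k) x • a) (x a : H) :
    x * a = a * x := by
  have hc : adjointFun (k := k) a = toConv (LinearMap.mulRight k a) * toConv (antipode k) := rfl
  have key := congr($hc * toConv LinearMap.id)
  rw [mul_assoc, LinearMap.antipode_mul_id, mul_one] at key
  have hx := congr($key x)
  rw [(ℛ k x).convMul_apply] at hx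
  refine hx.symm.trans ?_
  have h' : ∀ y, adjointFun (k := k) a y = counit (R := k) y • a := fun y => h y a
  simp only [h', LinearMap.id_apply, smul_mul_assoc]
  simp only [← mul_smul_comm, ← Finset.mul_sum, sum_counit_smul]

end
end HopfAlgebra

/-! ### Test objects from Yetter–Drinfeld structures on `H`. -/

namespace LRBimodule
section
variable {k : Type u} {H : Type v} [Field k] [Ring H] [HopfAlgebra k H]

variable (k H) in
/-- The trivial right action `m · h = ε(h) m`. -/
noncomputable def trivialRact (V : Type*) [AddCommGroup V] [Module k V] :
    Hᵐᵒᵖ →ₐ[k] Module.End k V :=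
  (Algebra.ofId k (Module.End k V)).comp
    (AlgHom.fromOpposite (Bialgebra.counitAlgHom k H) fun _ _ => mul_comm _ _)

@[simp] lemma trivialRact_op (V : Type*) [AddCommGroup V] [Module k V] (h : H) (m : V) :
    trivialRact k H V (op h) m = counit (R := k) h • m := rfl

lemma lTensor_trivialRact (V : Type*) [AddCommGroup V] [Module k V] (h : H) (t : H ⊗[k] V) :
    LinearMap.lTensor H (trivialRact k H V (op h)) t = counit (R := k) h • t := by
  induction t with
  | zero => simp
  | add x y hx hy => simp only [map_add, smul_add, hx, hy]
  | tmul a b => simp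

/-- A left-left Yetter-Drinfeld module structure on `V`, transported along `e : W ≃ V`, as a
Yetter-Drinfeld-Long bimodule with trivial right action and right coaction. -/
noncomputable def ofYetterDrinfeld {V : Type*} {W : Type w} [AddCommGroup V] [Module k V]
    [AddCommGroup W] [Module k W] (e : W ≃ₗ[k] V) (act : H →ₐ[k] Module.End k V)
    (coact : V →ₗ[k] H ⊗[k] V)
    (coassoc : (TensorProduct.assoc k H H V).toLinearMap ∘ₗ LinearMap.rTensor V comul ∘ₗ coact =
      LinearMap.lTensor H coact ∘ₗ coact)
    (counit_coact : ∀ m, LinearMap.rTensor V (counit (R := k)) (coact m) = 1 ⊗ₜ m)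
    (yd : ∀ (h : H) (m : V) (r : Repr k h (H × H)),
      ∑ i ∈ r.index, LinearMap.rTensor V (LinearMap.mulRight k (r.right i))
        (coact (act (r.left i) m)) =
      ∑ i ∈ r.index, TensorProduct.map (LinearMap.mulLeft k (r.left i)) (act (r.right i))
        (coact m)) : LRBimodule.{u, v, w} k H where
  carrier := W
  lact := (e.symm.conjAlgEquiv k).toAlgHom.comp act
  ract := trivialRact k H W
  lact_ract h h' m := by simp
  lcoact := LinearMap.lTensor H e.symm.toLinearMap ∘ₗ coact ∘ₗ e.toLinearMap
  lcoact_coassoc := by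
    ext m
    have h := LinearMap.congr_fun coassoc (e m)
    simp only [LinearMap.comp_apply, LinearEquiv.coe_coe] at h ⊢
    have hl : ∀ t : H ⊗[k] V, TensorProduct.assoc k H H W (LinearMap.rTensor W comul
        (LinearMap.lTensor H e.symm.toLinearMap t)) =
        LinearMap.lTensor H (LinearMap.lTensor H e.symm.toLinearMap)
          (TensorProduct.assoc k H H V (LinearMap.rTensor V comul t)) := by
      intro t
      induction t with
      | zero => simp
      | add x y hx hy => simp only [map_add, hx, hy]
      | tmul a b =>
        simp only [LinearMap.lTensor_tmul, LinearMap.rTensor_tmul]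
        induction comul (R := k) a with
        | zero => simp
        | add x y hx hy => simp only [TensorProduct.add_tmul, map_add, hx, hy]
        | tmul c d => simp
    rw [hl, h]
    induction coact (e m) with
    | zero => simp
    | add x y hx hy => simp only [map_add, hx, hy]
    | tmul a b => simp
  lcoact_counit := by
    ext m
    have h := congrArg (LinearMap.lTensor k e.symm.toLinearMap) (counit_coact (e m))
    simp only [LinearMap.lTensor_tmul, LinearEquiv.coe_coe, LinearEquiv.symm_apply_apply] at h
    refine Eq.trans ?_ h
    simp only [LinearMap.comp_apply, LinearEquiv.coe_coe]
    induction coact (e m) with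
    | zero => simp
    | add x y hx hy => simp only [map_add, hx, hy]
    | tmul a b => simp
  rcoact := (TensorProduct.mk k W H).flip 1
  rcoact_coassoc := by ext m; simp [Algebra.TensorProduct.one_def]
  rcoact_counit := by ext m; simp
  lcoact_rcoact := by
    ext m
    simp only [LinearMap.comp_apply, LinearMap.flip_apply, TensorProduct.mk_apply,
      LinearMap.rTensor_tmul, LinearEquiv.coe_coe]
    induction coact (e m) with
    | zero => simp
    | add x y hx hy => simp only [map_add, TensorProduct.add_tmul, hx, hy]
    | tmul a b => simp
  yd_left h m r := by
    have h := congrArg (LinearMap.lTensor H e.symm.toLinearMap) (yd h (e m) r)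
    simp only [map_sum] at h
    refine Eq.trans ?_ (h.trans ?_)
    · refine Finset.sum_congr rfl fun i _ => ?_
      have he : e (((e.symm.conjAlgEquiv k).toAlgHom.comp act) (r.left i) m) =
        act (r.left i) (e m) := by simp
      simp only [LinearMap.comp_apply, LinearEquiv.coe_coe, he]
      induction coact (act (r.left i) (e m)) with
      | zero => simp
      | add x y hx hy => simp only [map_add, hx, hy]
      | tmul a b => simp
    · refine Finset.sum_congr rfl fun i _ => ?_
      simp only [LinearMap.comp_apply, LinearEquiv.coe_coe]
      induction coact (e m) with
      | zero => simp
      | add x y hx hy => simp only [map_add, hx, hy]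
      | tmul a b => simp
  long_left h m := by simp
  yd_right h m r := by
    -- With trivial right structures both sides reduce to `m ⊗ h` by the counit axioms.
    simp only [trivialRact_op, map_smul, LinearMap.flip_apply, TensorProduct.mk_apply,
      LinearMap.lTensor_tmul, TensorProduct.map_tmul, LinearMap.mulLeft_apply,
      LinearMap.mulRight_apply, mul_one, one_mul, TensorProduct.smul_tmul,
      ← TensorProduct.tmul_smul, ← TensorProduct.tmul_sum]
    rw [sum_counit_smul]
    congr 1
    have := congrArg (TensorProduct.rid k H) (sum_tmul_counit_eq r)
    simpa only [map_sum, TensorProduct.rid_tmul, one_smul] using this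
  long_right h m := by
    rw [lTensor_trivialRact, trivialRact_op, map_smul]

variable (k H) in
/-- `H` with left multiplication, the coadjoint coaction, and trivial right structures. -/
noncomputable def regular : LRBimodule.{u, v, max v w} k H :=
  ofYetterDrinfeld (ULift.moduleEquiv : ULift.{w} H ≃ₗ[k] H) (Algebra.lmul k H) (coadjoint k H)
    coadjoint_coassoc coadjoint_comul_counit coadjoint_yetterDrinfeld

variable (k H) in
/-- `H` with the adjoint action, the comultiplication, and trivial right structures. -/
noncomputable def adjointObj : LRBimodule.{u, v, max v w} k H :=
  ofYetterDrinfeld (ULift.moduleEquiv : ULift.{w} H ≃ₗ[k] H) (adjoint k H) comul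
    Coalgebra.coassoc rTensor_counit_comul adjoint_yetterDrinfeld

variable (k H) in
/-- The underlying space of `regular k H`. -/
noncomputable def regularEquiv : regular.{u, v, w} k H ≃ₗ[k] H :=
  (ULift.moduleEquiv : ULift.{w} H ≃ₗ[k] H)

variable (k H) in
/-- The underlying space of `adjointObj k H`. -/
noncomputable def adjointEquiv : adjointObj.{u, v, w} k H ≃ₗ[k] H :=
  (ULift.moduleEquiv : ULift.{w} H ≃ₗ[k] H)

lemma regular_rcoact (m : regular.{u, v, w} k H) : (regular k H).rcoact m = m ⊗ₜ 1 := rfl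

lemma adjointObj_rcoact (m : adjointObj.{u, v, w} k H) : (adjointObj k H).rcoact m = m ⊗ₜ 1 := rfl

lemma regular_lact (h : H) (m : regular.{u, v, w} k H) :
    (regular k H).lact h m = (regularEquiv k H).symm (h * regularEquiv k H m) := rfl

lemma adjointObj_lact (h : H) (m : adjointObj.{u, v, w} k H) :
    (adjointObj k H).lact h m = (adjointEquiv k H).symm (adjoint k H h (adjointEquiv k H m)) := rfl

lemma regular_lcoact (m : regular.{u, v, w} k H) :
    (regular k H).lcoact m = LinearMap.lTensor H (regularEquiv k H).symm.toLinearMap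
      (coadjoint k H (regularEquiv k H m)) := rfl

lemma adjointObj_lcoact (m : adjointObj.{u, v, w} k H) :
    (adjointObj k H).lcoact m = LinearMap.lTensor H (adjointEquiv k H).symm.toLinearMap
      (comul (adjointEquiv k H m)) := rfl

variable (k H) in
/-- The unit of `H`, a coinvariant element of `regular k H`. -/
noncomputable def regularOne : regular.{u, v, w} k H := (regularEquiv k H).symm 1

lemma lcoact_regularOne : (regular.{u, v, w} k H).lcoact (regularOne k H) = 1 ⊗ₜ regularOne k H := by
  simp [regular_lcoact, regularOne, coadjoint_one]

end

/-! ### The braiding on the test objects. -/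

section
variable {k : Type u} {H : Type v} [Field k] [Ring H] [HopfAlgebra k H] [FiniteDimensional k H]

lemma antipodeInv_antipode (x : H) : antipodeInv k H (antipode k x) = x :=
  antipode_injective k H (antipode_antipodeInv _)

lemma antipodeInv_one : antipodeInv k H 1 = 1 := by
  simpa using antipodeInv_antipode (k := k) (1 : H)

lemma canonicalBraiding_tmul_of_trivial (M N : LRBimodule.{u, v, w} k H) (m : M) (n : N)
    (hn : N.rcoact n = n ⊗ₜ 1) :
    canonicalBraiding k H M N (m ⊗ₜ n) =
      LinearMap.rTensor M (N.lact.toLinearMap.flip n) (M.lcoact m) := by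
  change braidingHom M N (m ⊗ₜ n) = _
  rw [braidingHom_tmul, hn]
  induction M.lcoact m with
  | zero => simp
  | add x y hx hy => simp only [map_add, TensorProduct.add_tmul, hx, hy]
  | tmul a b => simp

lemma canonicalBraiding_symm_tmul_of_trivial (M N : LRBimodule.{u, v, w} k H) (m : M) (n : N)
    (hn : N.rcoact n = n ⊗ₜ 1) :
    (canonicalBraiding k H M N).symm (n ⊗ₜ m) = TensorProduct.comm k N M
      (LinearMap.rTensor M (N.lact.toLinearMap.flip n ∘ₗ antipodeInv k H) (M.lcoact m)) := by
  change braidingInv M N (n ⊗ₜ m) = _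
  rw [braidingInv_tmul, hn]
  congr 1
  induction M.lcoact m with
  | zero => simp
  | add x y hx hy => simp only [map_add, TensorProduct.add_tmul, hx, hy]
  | tmul a b => simp [antipodeInv_one]


/-- A functional that sees the action on `n` only through `ε` reduces the coaction of `m` to its
counit, so under it the braiding acts like the flip. It is used with `ε` on `adjointObj`. -/
lemma lid_map_canonicalBraiding {V : Type*} [AddCommGroup V] [Module k V]
    (M N : LRBimodule.{u, v, w} k H) (m : M) (n : N) (hn : N.rcoact n = n ⊗ₜ 1)
    (φ : Module.Dual k N) (hφ : ∀ h, φ (N.lact h n) = counit (R := k) h * φ n) (g : M →ₗ[k] V) :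
    TensorProduct.lid k V (TensorProduct.map φ g (canonicalBraiding k H M N (m ⊗ₜ n))) =
      φ n • g m := by
  have h := congrArg (fun t => φ n • TensorProduct.lid k V (LinearMap.lTensor k g t))
    (LinearMap.congr_fun M.lcoact_counit m)
  simp only [TensorProduct.mk_apply, LinearMap.lTensor_tmul, TensorProduct.lid_tmul,
    one_smul] at h
  rw [canonicalBraiding_tmul_of_trivial M N m n hn, ← h, LinearMap.comp_apply]
  induction M.lcoact m with
  | zero => simp
  | add x y hx hy => simp only [map_add, smul_add, hx, hy]
  | tmul a b => simp [hφ, smul_smul, mul_comm]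

lemma canonicalBraiding_regularOne (N : LRBimodule.{u, v, max v w} k H) (n : N)
    (hn : N.rcoact n = n ⊗ₜ 1) :
    canonicalBraiding k H (regular.{u, v, w} k H) N (regularOne k H ⊗ₜ n) =
      n ⊗ₜ regularOne k H := by
  simp [canonicalBraiding_tmul_of_trivial _ _ _ _ hn, lcoact_regularOne]

/-- `S⁻¹(a₁)` acts on the unit of `regular` by multiplication, hence appears there unchanged: this
is how arbitrary elements enter that factor. -/
lemma canonicalBraiding_symm_regularOne (a : adjointObj.{u, v, w} k H) {ι : Type*}
    (r : Repr k (adjointEquiv k H a) ι) :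
    (canonicalBraiding k H (adjointObj.{u, v, w} k H) (regular.{u, v, w} k H)).symm
      (regularOne k H ⊗ₜ a) = ∑ i ∈ r.index, (adjointEquiv k H).symm (r.right i) ⊗ₜ
        (regularEquiv k H).symm (antipodeInv k H (r.left i)) := by
  rw [canonicalBraiding_symm_tmul_of_trivial _ _ _ _ (regular_rcoact _), adjointObj_lcoact, ← r.eq]
  simp [regular_lact, regularOne]

lemma canonicalBraiding_adjointObj (a b : adjointObj.{u, v, w} k H) {ι : Type*}
    (r : Repr k (adjointEquiv k H a) ι) :
    canonicalBraiding k H (adjointObj.{u, v, w} k H) (adjointObj.{u, v, w} k H) (a ⊗ₜ b) =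
      ∑ i ∈ r.index, (adjointObj k H).lact (r.left i) b ⊗ₜ
        (adjointEquiv k H).symm (r.right i) := by
  rw [canonicalBraiding_tmul_of_trivial _ _ _ _ (adjointObj_rcoact _), adjointObj_lcoact, ← r.eq]
  simp

/-- Acting on the unit by multiplication records the acting element, so the braiding with the unit
reads off the whole coaction. -/
lemma map_canonicalBraiding_regular_regularOne (m : regular.{u, v, w} k H) :
    TensorProduct.map (regularEquiv k H).toLinearMap (regularEquiv k H).toLinearMap
      (canonicalBraiding k H (regular.{u, v, w} k H) (regular.{u, v, w} k H)
        (m ⊗ₜ regularOne k H)) = coadjoint k H (regularEquiv k H m) := by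
  rw [canonicalBraiding_tmul_of_trivial _ _ _ _ (regular_rcoact _), regular_lcoact]
  induction coadjoint k H (regularEquiv k H m) with
  | zero => simp
  | add x y hx hy => simp only [map_add, hx, hy]
  | tmul a b => simp [regular_lact, regularOne]

end
end LRBimodule

/-! ### Necessity of cocommutativity and commutativity. -/

namespace LRBimodule
section
variable {k : Type u} {H : Type v} [Field k] [Ring H] [HopfAlgebra k H] [FiniteDimensional k H]

theorem isCocomm_of_isPseudosymmetric
    (h : IsPseudosymmetric (canonicalBraiding.{u, v, max v w} k H)) : IsCocomm k H := by
  refine isCocomm_of_coadjoint_eq fun x => ?_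
  -- The inverse braiding produces `S⁻¹` of an element, so `x` is written in that form.
  obtain ⟨z, rfl⟩ : ∃ z, antipodeInv k H z = x := ⟨_, antipodeInv_antipode x⟩
  have h1 := LinearMap.congr_fun (h (regular.{u, v, w} k H) (regular.{u, v, w} k H)
    (adjointObj.{u, v, w} k H))
    ((regularOne.{u, v, w} k H ⊗ₜ regularOne k H) ⊗ₜ (adjointEquiv k H).symm z)
  let ε : Module.Dual k (adjointObj.{u, v, w} k H) := counit ∘ₗ (adjointEquiv k H).toLinearMap
  let e := (regularEquiv.{u, v, w} k H).toLinearMap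
  -- The two sides are `z₂ ⊗ 1 ⊗ S⁻¹(z₁)` and `z₂ ⊗ δ(S⁻¹(z₁))`, with `δ` the coadjoint coaction;
  -- `ε` on the first leg removes `z₂`.
  have h2 := congrArg (fun t => TensorProduct.lid k (H ⊗[k] H) (TensorProduct.map ε
    (TensorProduct.map e e) (TensorProduct.assoc k _ _ _ t))) h1
  let r : Repr k (adjointEquiv.{u, v, w} k H ((adjointEquiv k H).symm z)) (H × H) := ℛ k _
  have hr : ∀ g : H →ₗ[k] H ⊗[k] H,
      ∑ i ∈ r.index, counit (R := k) (r.right i) • g (r.left i) = g z := by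
    intro g
    simp only [← map_smul, ← map_sum]
    congr 1
    have := congrArg (TensorProduct.rid k H) (sum_tmul_counit_eq r)
    simpa only [map_sum, TensorProduct.rid_tmul, one_smul,
      LinearEquiv.apply_symm_apply] using this
  have hmap := map_canonicalBraiding_regular_regularOne.{u, v, w} (k := k) (H := H)
  have hreg := fun n => canonicalBraiding_regularOne (regular.{u, v, w} k H) n (regular_rcoact n)
  have hadj := fun n =>
    canonicalBraiding_regularOne (adjointObj.{u, v, w} k H) n (adjointObj_rcoact n)
  simp only [LinearMap.comp_apply, LinearEquiv.coe_coe, LinearMap.rTensor_tmul,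
    LinearMap.lTensor_tmul, hreg, hadj, TensorProduct.assoc_tmul,
    canonicalBraiding_symm_regularOne.{u, v, w} _ r, TensorProduct.sum_tmul,
    TensorProduct.tmul_sum, map_sum, hmap, TensorProduct.assoc_symm_tmul,
    LinearEquiv.apply_symm_apply, TensorProduct.map_tmul, TensorProduct.lid_tmul, ε, e] at h2
  have h3 := hr (TensorProduct.mk k H H 1 ∘ₗ antipodeInv k H)
  have h4 := hr (coadjoint k H ∘ₗ antipodeInv k H)
  simp only [LinearMap.comp_apply, TensorProduct.mk_apply] at h3 h4
  rw [← h3, ← h4]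
  simpa [regularOne] using h2.symm

theorem commute_of_isPseudosymmetric
    (h : IsPseudosymmetric (canonicalBraiding.{u, v, max v w} k H)) (a b : H) : a * b = b * a := by
  refine commute_of_adjoint_eq (k := k) (fun y z => ?_) a b
  have h1 := LinearMap.congr_fun (h (regular.{u, v, w} k H) (adjointObj.{u, v, w} k H)
    (adjointObj.{u, v, w} k H))
    ((regularOne.{u, v, w} k H ⊗ₜ (adjointEquiv k H).symm y) ⊗ₜ (adjointEquiv k H).symm z)
  let ε : Module.Dual k (adjointObj.{u, v, w} k H) := counit ∘ₗ (adjointEquiv k H).toLinearMap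
  have hε : ∀ (n : adjointObj.{u, v, w} k H) (h : H),
      ε ((adjointObj k H).lact h n) = counit (R := k) h * ε n := by
    intro n h
    simp [ε, adjointObj_lact, counit_adjoint]
  -- The antipode undoes the `S⁻¹` that the inverse braiding leaves in the `regular` factor.
  let e : regular.{u, v, w} k H →ₗ[k] H := antipode k ∘ₗ (regularEquiv.{u, v, w} k H).toLinearMap
  have hcε := fun (M : LRBimodule.{u, v, max v w} k H) (m : M) (n : adjointObj.{u, v, w} k H) =>
    lid_map_canonicalBraiding (V := H) M (adjointObj.{u, v, w} k H) m n (adjointObj_rcoact n) ε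
      (hε n)
  have hadj := fun n =>
    canonicalBraiding_regularOne (adjointObj.{u, v, w} k H) n (adjointObj_rcoact n)
  have h2 := congrArg (fun t => TensorProduct.lid k H (TensorProduct.map
    ((TensorProduct.lid k k).toLinearMap ∘ₗ TensorProduct.map ε ε) e t)) h1
  have hassoc : ∀ a t, TensorProduct.lid k H (TensorProduct.map
      ((TensorProduct.lid k k).toLinearMap ∘ₗ TensorProduct.map ε ε) e
        ((TensorProduct.assoc k _ _ _).symm (a ⊗ₜ t))) =
      ε a • TensorProduct.lid k H (TensorProduct.map ε e t) := by
    intro a t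
    induction t with
    | zero => simp
    | add x y hx hy => simp only [TensorProduct.tmul_add, map_add, smul_add, hx, hy]
    | tmul c d => simp [smul_smul]
  let R (a : H) : Repr k (adjointEquiv.{u, v, w} k H ((adjointEquiv k H).symm a)) (H × H) := ℛ k _
  have hR : ∀ x (g : H →ₗ[k] H),
      ∑ i ∈ (R x).index, counit (R := k) ((R x).right i) • g ((R x).left i) = g x := by
    intro x g
    simp only [← map_smul, ← map_sum]
    congr 1
    have := congrArg (TensorProduct.rid k H) (sum_tmul_counit_eq (R x))
    simpa only [map_sum, TensorProduct.rid_tmul, one_smul,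
      LinearEquiv.apply_symm_apply] using this
  simp only [LinearMap.comp_apply, LinearEquiv.coe_coe, LinearMap.rTensor_tmul,
    LinearMap.lTensor_tmul, hadj, TensorProduct.assoc_tmul,
    canonicalBraiding_adjointObj.{u, v, w} _ _ (R y), TensorProduct.sum_tmul, TensorProduct.tmul_sum, map_sum,
    TensorProduct.assoc_symm_tmul, TensorProduct.map_tmul, adjointObj_lact,
    LinearEquiv.apply_symm_apply, fun x => canonicalBraiding_symm_regularOne.{u, v, w} _ (R x), hassoc, hcε,
    TensorProduct.lid_tmul] at h2
  have hε' : ∀ x, ε ((adjointEquiv k H).symm x) = counit (R := k) x := fun x => by simp [ε]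
  have he : ∀ x, e ((regularEquiv k H).symm (antipodeInv k H x)) = x := fun x => by simp [e]
  simp only [hε', he, counit_adjoint] at h2
  -- Here and in `hr` the counit axiom collapses the sums: one side of `h2` becomes `ε(y) z`, the
  -- other the adjoint action of `y` on `z`.
  have hl : ∀ c d : H, ∑ i ∈ (R y).index,
      ((counit (R := k) ((R y).left i) * counit (R := k) c) • counit (R := k) ((R y).right i)) • d =
      counit (R := k) c • counit (R := k) y • d := by
    intro c d
    have := hR y (LinearMap.toSpanSingleton k H d ∘ₗ counit)
    simp only [LinearMap.comp_apply, LinearMap.toSpanSingleton_apply] at this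
    rw [← this, Finset.smul_sum]
    refine Finset.sum_congr rfl fun i _ => ?_
    simp only [smul_smul, smul_eq_mul]
    congr 1
    ring
  have hr : ∀ i, ∑ j ∈ (R (adjoint k H ((R y).left i) z)).index,
      counit (R := k) ((R (adjoint k H ((R y).left i) z)).right j) •
        counit (R := k) ((R y).right i) • (R (adjoint k H ((R y).left i) z)).left j =
      counit (R := k) ((R y).right i) • adjoint k H ((R y).left i) z := fun i =>
    hR _ (counit (R := k) ((R y).right i) • LinearMap.id)
  simp only [hl, hr] at h2
  refine ((hR y ((adjoint k H).toLinearMap.flip z)).symm.trans h2.symm).trans ?_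
  exact hR z (counit (R := k) y • LinearMap.id)
end
end LRBimodule

/-- The objects live in the universe `max v w` so that the lifted copies of `H` used as test objects
are among them; `w` stays arbitrary. -/
theorem proposition2p5 {k : Type u} {H : Type v} [Field k] [Ring H] [HopfAlgebra k H]
    [FiniteDimensional k H] :
    LRBimodule.IsPseudosymmetric (LRBimodule.canonicalBraiding.{u, v, max v w} k H) ↔
      (∀ a b : H, a * b = b * a) ∧ Coalgebra.IsCocomm k H :=
  ⟨fun h => ⟨LRBimodule.commute_of_isPseudosymmetric.{u, v, w} h,
    LRBimodule.isCocomm_of_isPseudosymmetric.{u, v, w} h⟩,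
    fun ⟨hcomm, _⟩ => LRBimodule.isPseudosymmetric_of_comm_of_isCocomm hcomm⟩
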